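/- Let $q$ be a prime power, and let $f(X,Y)=aX^2+bXY+cY^2$ be a binary quadratic form that is irreducible over $\mathbb{F}_q$. Let $Q(x)=x_1x_2+x_3x_4+f(x_5,x_6)$ on $\mathbb{F}_q^6$, and let $B(x,y)=Q(x+y)-Q(x)-Q(y)$. The points of the generalized quadrangle $\mathcal{Q}^-(5,q)$ are the subspaces $\langle x\rangle$ with $x\neq 0$ and $Q(x)=0$. Its collinearity graph $\Gamma$ has the points as its vertices, and two distinct points $\langle x\rangle,\langle y\rangle$ are adjacent if and only if $B(x,y)=0$. For a graph on a finite vertex set $\Omega$, let $A_0,A_1,A_2\in\mathrm{Mat}_{\Omega}(\mathbb{C})$ be the adjacency matrices of equality, adjacency, and non-adjacency of distinct vertices. For $\omega\in\Omega$ let $E^*_{i,\omega}$ be the diagonal $0/1$ matrix whose $(\alpha,\alpha)$ entry is $(A_i)_{\omega,\alpha}$. Put $$T_{0,\omega}=\operatorname{Span}_{\mathbb{C}}\{E^*_{i,\omega}A_jE^*_{k,\omega}:0\le i,j,k\le 2\},$$ let $T_\omega$ be the subalgebra of $\mathrm{Mat}_{\Omega}(\mathbb{C})$ generated by $A_0,A_1,A_2,E^*_{0,\omega},E^*_{1,\omega},E^*_{2,\omega}$,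 and let $\widetilde T_\omega$ be the algebra of all matrices that commute with the permutation matrices of all automorphisms of the graph fixing $\omega$. A strongly regular graph is triply-transitive if it is vertex-transitive and $T_{0,\omega}=T_\omega=\widetilde T_\omega$ for every vertex $\omega$. **Theorem.** The graph $\Gamma$ is a strongly regular graph that is triply-transitive. Moreover, for every vertex $\omega$, $\dim T_{0,\omega}=15$, and $$\bigl(\dim E^*_{i,\omega}\widetilde T_\omega E^*_{j,\omega}\bigr)_{0\le i,j\le 2}=\begin{bmatrix}1&1&1\\1&3&2\\1&2&3\end{bmatrix},$$ so that $\dim\widetilde T_\omega=15$. -/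

import Mathlib

open scoped LinearAlgebra.Projectivization

namespace SimpleGraph

noncomputable section

variable {V : Type*} (G : SimpleGraph V)

/-- The three relations of the association scheme of a graph `G`:
`0` is equality, `1` is adjacency, `2` is non-adjacency of distinct vertices. -/
def schemeRel (i : Fin 3) (x y : V) : Prop :=
  match i with
  | 0 => x = y
  | 1 => G.Adj x y
  | 2 => x ≠ y ∧ ¬ G.Adj x y

open Classical in
/-- The complex adjacency matrix `A_i` of the relation `R_i`. -/
def schemeAdj (i : Fin 3) : Matrix V V ℂ :=
  Matrix.of fun x y => if G.schemeRel i x y then 1 else 0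

open Classical in
/-- The dual idempotent `E*_{i,ω}`: the diagonal projection onto `{α | (ω, α) ∈ R_i}`. -/
def dualIdem [DecidableEq V] (ω : V) (i : Fin 3) : Matrix V V ℂ :=
  Matrix.diagonal fun α => if G.schemeRel i ω α then 1 else 0

variable [Fintype V] [DecidableEq V]

/-- `T_{0,ω}`, the linear span of all `E*_{i,ω} A_j E*_{k,ω}`. -/
def terwilligerSpan (ω : V) : Submodule ℂ (Matrix V V ℂ) :=
  Submodule.span ℂ
    {M | ∃ i j k : Fin 3, M = G.dualIdem ω i * G.schemeAdj j * G.dualIdem ω k}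

/-- The Terwilliger algebra `T_ω`, generated by all `A_i` and all `E*_{i,ω}`. -/
def terwilligerAlgebra (ω : V) : Subalgebra ℂ (Matrix V V ℂ) :=
  Algebra.adjoin ℂ (Set.range G.schemeAdj ∪ Set.range (G.dualIdem ω))

/-- The centralizer algebra `T̃_ω`: all matrices commuting with the permutation matrices of the
automorphisms of `G` that fix `ω`. -/
def stabilizerCentralizer (ω : V) : Subalgebra ℂ (Matrix V V ℂ) :=
  Subalgebra.centralizer ℂ
    {P | ∃ g : G ≃g G, g ω = ω ∧ P = Equiv.Perm.permMatrix ℂ g.toEquiv}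

/-- The block `E*_{i,ω} T̃_ω E*_{j,ω}`. -/
def centralizerBlock (ω : V) (i j : Fin 3) : Submodule ℂ (Matrix V V ℂ) :=
  (Subalgebra.toSubmodule (G.stabilizerCentralizer ω)).map
    (LinearMap.mulLeftRight ℂ (G.dualIdem ω i, G.dualIdem ω j))

open Classical in
/-- A triply-transitive strongly regular graph. -/
structure IsTriplyTransitive : Prop where
  stronglyRegular : ∃ v k l m : ℕ, G.IsSRGWith v k l m
  vertexTransitive : ∀ x y : V, ∃ g : G ≃g G, g x = y
  span_eq_terwilliger : ∀ ω : V,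
    G.terwilligerSpan ω = Subalgebra.toSubmodule (G.terwilligerAlgebra ω)
  terwilliger_eq_centralizer : ∀ ω : V,
    G.terwilligerAlgebra ω = G.stabilizerCentralizer ω

end

end SimpleGraph

namespace PolarSpace

noncomputable section

/-- The singular points of a quadratic form: the one-dimensional subspaces on which it vanishes. -/
def Point {F V : Type*} [Field F] [AddCommGroup V] [Module F V] (Q : QuadraticForm F V) :=
  {p : ℙ F V // ∀ x ∈ p.submodule, Q x = 0}

instance {F V : Type*} [Field F] [AddCommGroup V] [Module F V] [Finite V]
    (Q : QuadraticForm F V) : Fintype (Point Q) :=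
  haveI : Finite (ℙ F V) := Quotient.finite _
  haveI : Finite (Point Q) := Subtype.finite
  Fintype.ofFinite _

instance {F V : Type*} [Field F] [AddCommGroup V] [Module F V]
    (Q : QuadraticForm F V) : DecidableEq (Point Q) :=
  Classical.decEq _

/-- The collinearity graph: distinct singular points are adjacent when they are orthogonal for the
bilinear form `B(x, y) = Q(x + y) - Q(x) - Q(y)`. -/
def collinearityGraph {F V : Type*} [Field F] [AddCommGroup V] [Module F V]
    (Q : QuadraticForm F V) : SimpleGraph (Point Q) where
  Adj p r := p ≠ r ∧ ∀ x ∈ p.1.submodule, ∀ y ∈ r.1.submodule, QuadraticMap.polar Q x y = 0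
  symm := ⟨fun _ _ h =>
    ⟨h.1.symm, fun x hx y hy => by rw [QuadraticMap.polar_comm]; exact h.2 y hy x hx⟩⟩
  loopless := ⟨fun _ h => h.1 rfl⟩

/-- The binary quadratic form `a X² + b X Y + c Y²`, as a polynomial. -/
def binaryPoly {F : Type*} [Field F] (a b c : F) : MvPolynomial (Fin 2) F :=
  MvPolynomial.C a * MvPolynomial.X 0 ^ 2
    + MvPolynomial.C b * MvPolynomial.X 0 * MvPolynomial.X 1
    + MvPolynomial.C c * MvPolynomial.X 1 ^ 2

/-- The quadratic form `x₁x₂ + x₃x₄ + a x₅² + b x₅x₆ + c x₆²` on `F⁶`. It is of minus type,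
and defines `Q⁻(5,q)`, when `a X² + b X Y + c Y²` is irreducible over `F` and `|F| = q`. -/
def ellipticForm {F : Type*} [Field F] (a b c : F) : QuadraticForm F (Fin 6 → F) :=
  QuadraticMap.proj 0 1 + QuadraticMap.proj 2 3
    + a • QuadraticMap.proj 4 4 + b • QuadraticMap.proj 4 5 + c • QuadraticMap.proj 5 5

theorem ellipticForm_apply {F : Type*} [Field F] (a b c : F) (x : Fin 6 → F) :
    ellipticForm a b c x
      = x 0 * x 1 + x 2 * x 3 + MvPolynomial.eval ![x 4, x 5] (binaryPoly a b c) := by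
  simp [ellipticForm, binaryPoly]
  ring

end

end PolarSpace

/-! Everything follows from one fact: two ordered triples of vertices lie in the same orbit of the
automorphism group as soon as their pairwise relations agree (`IsTripleHomogeneous`). A matrix
commuting with the stabilizer of `ω` is then constant on the pairs `(x, y)` for which `(ω, x, y)`
has a given type. It is therefore a combination of the 0/1 matrices `E*ᵢ Aⱼ E*ₖ`, and T̃ ≤ T₀ ≤ T ≤
T̃ closes up. The nonzero matrices among these have disjoint supports, so dimensions are numbers of
types that occur. Strong regularity needs only homogeneity on pairs.

Homogeneity is proved by moving every triple to a normal form with explicit similitudes of the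
quadratic form: Siegel transformations, coordinate exchanges and block scalings. Permuting the three
vertices leaves the degenerate types and four others. Irreducibility enters as anisotropy of `f`. It
forces a point collinear with two points of a line onto that line, which settles the collinear type.

For three pairwise non-collinear points isometries need not suffice: scaling the representatives
changes the product of the three values of `B` only by a square. A similitude with prescribed
multiplier is needed. It exists because the norm form of the quadratic extension takes every value
over a finite field (`IsAnisotropic.exists_norm_eq`). -/

namespace SimpleGraph

noncomputable section

/-! ### Types of triples of vertices. -/

section RelIndex

variable {V : Type*} (G : SimpleGraph V)

open Classical in
/-- The index of the relation of the scheme of `G` that contains a given pair of vertices. -/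
def relIndex (x y : V) : Fin 3 :=
  if x = y then 0 else if G.Adj x y then 1 else 2

theorem schemeRel_iff (i : Fin 3) (x y : V) : G.schemeRel i x y ↔ G.relIndex x y = i := by
  unfold relIndex
  fin_cases i <;> simp only [schemeRel] <;> split_ifs with h1 h2 <;> simp_all

theorem relIndex_self (x : V) : G.relIndex x x = 0 := by simp [relIndex]

theorem relIndex_eq_zero {x y : V} : G.relIndex x y = 0 ↔ x = y :=
  (G.schemeRel_iff 0 x y).symm

theorem relIndex_eq_one {x y : V} : G.relIndex x y = 1 ↔ G.Adj x y :=
  (G.schemeRel_iff 1 x y).symm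

theorem relIndex_eq_two {x y : V} : G.relIndex x y = 2 ↔ x ≠ y ∧ ¬ G.Adj x y :=
  (G.schemeRel_iff 2 x y).symm

theorem relIndex_comm (x y : V) : G.relIndex x y = G.relIndex y x := by
  unfold relIndex
  rw [G.adj_comm x y]
  congr 1
  exact propext eq_comm

theorem relIndex_map {G} (g : G ≃g G) (x y : V) : G.relIndex (g x) (g y) = G.relIndex x y := by
  have h₁ : (g x = g y) = (x = y) := propext g.injective.eq_iff
  have h₂ : G.Adj (g x) (g y) = G.Adj x y := propext g.map_adj_iff
  unfold relIndex
  rw [h₁, h₂]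

/-- The relations between the three pairs of the triple `(ω, x, y)`. -/
def tripleType (ω x y : V) : Fin 3 × Fin 3 × Fin 3 :=
  (G.relIndex ω x, G.relIndex x y, G.relIndex ω y)

theorem tripleType_map {G} (g : G ≃g G) (ω x y : V) :
    G.tripleType (g ω) (g x) (g y) = G.tripleType ω x y := by
  simp [tripleType, relIndex_map]

/-- The triple types compatible with `0` being the index of equality. -/
def admissibleTypes : Finset (Fin 3 × Fin 3 × Fin 3) :=
  Finset.univ.filter fun t =>
    (t.1 = 0 → t.2.1 = t.2.2) ∧ (t.2.2 = 0 → t.1 = t.2.1) ∧ (t.2.1 = 0 → t.1 = t.2.2)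

theorem tripleType_mem_admissibleTypes (ω x y : V) : G.tripleType ω x y ∈ admissibleTypes := by
  simp only [admissibleTypes, tripleType, Finset.mem_filter, Finset.mem_univ, true_and,
    relIndex_eq_zero]
  refine ⟨?_, ?_, ?_⟩
  · rintro rfl; rfl
  · rintro rfl; exact G.relIndex_comm _ _
  · rintro rfl; rfl

/-- The admissible types with given first and last entry. -/
def blockTypes (i k : Fin 3) : Finset (Fin 3 × Fin 3 × Fin 3) :=
  admissibleTypes.filter fun t => t.1 = i ∧ t.2.2 = k

/-- Every automorphism orbit on triples of vertices is determined by the triple type. -/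
def IsTripleHomogeneous : Prop :=
  ∀ x y z x' y' z' : V, G.tripleType x y z = G.tripleType x' y' z' →
    ∃ g : G ≃g G, g x = x' ∧ g y = y' ∧ g z = z'

/-- Every type of triples of distinct vertices occurs. -/
def RealizesTriples : Prop :=
  ∀ i j k : Fin 3, i ≠ 0 → j ≠ 0 → k ≠ 0 → ∃ x y z : V, G.tripleType x y z = (i, j, k)

variable {G}

theorem IsTripleHomogeneous.exists_map_pair (h : G.IsTripleHomogeneous) {x y x' y' : V}
    (hxy : G.relIndex x y = G.relIndex x' y') : ∃ g : G ≃g G, g x = x' ∧ g y = y' := by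
  obtain ⟨g, h1, h2, -⟩ := h x y y x' y' y' (by simp [tripleType, relIndex_self, hxy])
  exact ⟨g, h1, h2⟩

theorem IsTripleHomogeneous.exists_map (h : G.IsTripleHomogeneous) (x y : V) :
    ∃ g : G ≃g G, g x = y := by
  obtain ⟨g, hg, -⟩ := h.exists_map_pair (x := x) (y := x) (x' := y) (y' := y)
    (by simp [relIndex_self])
  exact ⟨g, hg⟩

/-- A triple of the wanted type somewhere in the graph is moved by vertex-transitivity until it
starts at `ω`. Types with a zero entry come from degenerate triples. -/
theorem RealizesTriples.exists_tripleType_eq (hr : G.RealizesTriples)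
    (h : G.IsTripleHomogeneous) (ω : V) {t : Fin 3 × Fin 3 × Fin 3} (ht : t ∈ admissibleTypes) :
    ∃ x y, G.tripleType ω x y = t := by
  have key : ∀ i j k : Fin 3, i ≠ 0 → j ≠ 0 → k ≠ 0 → ∃ x y, G.tripleType ω x y = (i, j, k) := by
    intro i j k hi hj hk
    obtain ⟨x, y, z, hxyz⟩ := hr i j k hi hj hk
    obtain ⟨g, rfl⟩ := h.exists_map x ω
    exact ⟨g y, g z, by rw [tripleType_map, hxyz]⟩
  have key1 : ∀ i : Fin 3, ∃ x, G.relIndex ω x = i := by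
    intro i
    by_cases hi : i = 0
    · exact ⟨ω, by rw [hi, relIndex_self]⟩
    -- Only the first entry is used; the two 1s are arbitrary nonzero indices.
    · obtain ⟨x, y, hxy⟩ := key i 1 1 hi (by decide) (by decide)
      exact ⟨x, congrArg Prod.fst hxy⟩
  obtain ⟨i, j, k⟩ := t
  simp only [admissibleTypes, Finset.mem_filter, Finset.mem_univ, true_and] at ht
  obtain ⟨h1, h2, h3⟩ := ht
  by_cases hi : i = 0
  · obtain ⟨y, hy⟩ := key1 k
    exact ⟨ω, y, by simp [tripleType, relIndex_self, hy, h1 hi, hi]⟩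
  by_cases hk : k = 0
  · obtain ⟨y, hy⟩ := key1 i
    exact ⟨y, ω, by simp [tripleType, relIndex_self, G.relIndex_comm y ω, hy, ← h2 hk, hk]⟩
  by_cases hj : j = 0
  · obtain ⟨y, hy⟩ := key1 i
    exact ⟨y, y, by simp [tripleType, relIndex_self, hy, ← h3 hj, hj]⟩
  exact key i j k hi hj hk

end RelIndex

/-! ### Block matrices, the three algebras and their dimensions. -/

section Blocks

variable {V : Type*} (G : SimpleGraph V)

/-- The `0/1` matrix of the pairs `(x, y)` for which `(ω, x, y)` has type `t`. -/
def blockMatrix (ω : V) (t : Fin 3 × Fin 3 × Fin 3) : Matrix V V ℂ :=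
  Matrix.of fun x y => if G.tripleType ω x y = t then 1 else 0

theorem blockMatrix_apply (ω : V) (t : Fin 3 × Fin 3 × Fin 3) (x y : V) :
    G.blockMatrix ω t x y = if G.tripleType ω x y = t then 1 else 0 := rfl

theorem schemeAdj_apply (i : Fin 3) (x y : V) :
    G.schemeAdj i x y = if G.relIndex x y = i then 1 else 0 := by
  simp [schemeAdj, schemeRel_iff]

variable {G}

/-- The supports are disjoint and nonempty, so an entry of type `t` isolates the coefficient of `t`.
-/
theorem linearIndependent_blockMatrix {ω : V} {S : Finset (Fin 3 × Fin 3 × Fin 3)}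
    (hS : ∀ t ∈ S, ∃ x y, G.tripleType ω x y = t) :
    LinearIndependent ℂ fun t : S => G.blockMatrix ω t := by
  rw [Fintype.linearIndependent_iff]
  rintro c hc ⟨t, ht⟩
  obtain ⟨x, y, hxy⟩ := hS t ht
  have := congrFun (congrFun hc x) y
  simp only [Matrix.sum_apply, Matrix.smul_apply, blockMatrix_apply, hxy, Matrix.zero_apply] at this
  rw [Finset.sum_eq_single ⟨t, ht⟩] at this
  · simpa using this
  · rintro ⟨s, hs⟩ - hne
    have : t ≠ s := fun h => hne (by simp [h])
    simp [this]
  · simp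

theorem mem_span_blockMatrix {ω : V} {S : Finset (Fin 3 × Fin 3 × Fin 3)} {M : Matrix V V ℂ}
    (hM : ∀ x y x' y', G.tripleType ω x y = G.tripleType ω x' y' → M x y = M x' y')
    (hM0 : ∀ x y, G.tripleType ω x y ∉ S → M x y = 0) :
    M ∈ Submodule.span ℂ (Set.range fun t : S => G.blockMatrix ω t) := by
  classical
  -- The common value of `M` on pairs of type `t`; the default 0 is harmless, since the block matrix
  -- of a type that does not occur vanishes.
  let c : Fin 3 × Fin 3 × Fin 3 → ℂ := fun t =>
    if h : ∃ p : V × V, G.tripleType ω p.1 p.2 = t then M h.choose.1 h.choose.2 else 0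
  have hc : ∀ x y, c (G.tripleType ω x y) = M x y := by
    intro x y
    have h : ∃ p : V × V, G.tripleType ω p.1 p.2 = G.tripleType ω x y := ⟨(x, y), rfl⟩
    simp only [c, dif_pos h]
    exact hM _ _ _ _ h.choose_spec
  have hsum : M = ∑ t : S, c t • G.blockMatrix ω t := by
    ext x y
    simp only [Matrix.sum_apply, Matrix.smul_apply, blockMatrix_apply]
    by_cases hxy : G.tripleType ω x y ∈ S
    · rw [Finset.sum_eq_single ⟨_, hxy⟩]
      · simp [hc]
      · rintro ⟨s, hs⟩ - hne
        have : G.tripleType ω x y ≠ s := fun h => hne (by simp [h])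
        simp [this]
      · simp
    · rw [hM0 x y hxy, Finset.sum_eq_zero]
      rintro ⟨s, hs⟩ -
      have : G.tripleType ω x y ≠ s := fun h => hxy (h ▸ hs)
      simp [this]
  rw [hsum]
  exact Submodule.sum_mem _ fun t _ =>
    Submodule.smul_mem _ _ (Submodule.subset_span ⟨t, rfl⟩)

variable (G) [DecidableEq V]

theorem dualIdem_eq (ω : V) (i : Fin 3) :
    G.dualIdem ω i = Matrix.diagonal fun x => if G.relIndex ω x = i then 1 else 0 := by
  simp [dualIdem, schemeRel_iff]

variable [Fintype V]

theorem dualIdem_mul_mul_dualIdem_apply (ω : V) (i k : Fin 3) (M : Matrix V V ℂ) (x y : V) :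
    (G.dualIdem ω i * M * G.dualIdem ω k) x y
      = if G.relIndex ω x = i ∧ G.relIndex ω y = k then M x y else 0 := by
  rw [dualIdem_eq, dualIdem_eq, Matrix.mul_diagonal, Matrix.diagonal_mul]
  split_ifs <;> simp_all

theorem dualIdem_mul_schemeAdj_mul_dualIdem (ω : V) (i j k : Fin 3) :
    G.dualIdem ω i * G.schemeAdj j * G.dualIdem ω k = G.blockMatrix ω (i, j, k) := by
  ext x y
  rw [dualIdem_mul_mul_dualIdem_apply, schemeAdj_apply, blockMatrix_apply]
  simp only [tripleType, Prod.mk.injEq]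
  split_ifs <;> simp_all

variable {G}

/-- Commuting with a permutation matrix means invariance under simultaneous relabelling of rows and
columns. -/
theorem mem_stabilizerCentralizer_iff {ω : V} {M : Matrix V V ℂ} :
    M ∈ G.stabilizerCentralizer ω ↔
      ∀ g : G ≃g G, g ω = ω → ∀ x y, M (g x) (g y) = M x y := by
  have key : ∀ g : G ≃g G, Equiv.Perm.permMatrix ℂ g.toEquiv * M
      = M * Equiv.Perm.permMatrix ℂ g.toEquiv ↔ ∀ x y, M (g x) (g y) = M x y := by
    intro g
    rw [PEquiv.toMatrix_toPEquiv_mul, PEquiv.mul_toMatrix_toPEquiv, ← Matrix.ext_iff]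
    constructor
    · intro h x y
      have := h x (g y)
      simp only [Matrix.submatrix_apply, id] at this
      exact this.trans (congrArg (M x) (g.toEquiv.symm_apply_apply y))
    · intro h x y
      simp only [Matrix.submatrix_apply, id]
      rw [← h x (g.toEquiv.symm y)]
      exact congrArg (M (g x)) (g.toEquiv.apply_symm_apply y).symm
  rw [stabilizerCentralizer, Subalgebra.mem_centralizer_iff]
  constructor
  · intro h g hg
    exact (key g).1 (h _ ⟨g, hg, rfl⟩)
  · rintro h _ ⟨g, hg, rfl⟩
    exact (key g).2 (h g hg)

theorem terwilligerSpan_le (ω : V) :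
    G.terwilligerSpan ω ≤ Subalgebra.toSubmodule (G.terwilligerAlgebra ω) := by
  refine Submodule.span_le.2 ?_
  rintro _ ⟨i, j, k, rfl⟩
  exact (G.terwilligerAlgebra ω).mul_mem ((G.terwilligerAlgebra ω).mul_mem
    (Algebra.subset_adjoin (Or.inr ⟨i, rfl⟩)) (Algebra.subset_adjoin (Or.inl ⟨j, rfl⟩)))
    (Algebra.subset_adjoin (Or.inr ⟨k, rfl⟩))

theorem terwilligerAlgebra_le (ω : V) : G.terwilligerAlgebra ω ≤ G.stabilizerCentralizer ω := by
  refine Algebra.adjoin_le ?_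
  rintro _ (⟨i, rfl⟩ | ⟨i, rfl⟩) <;>
    refine mem_stabilizerCentralizer_iff.2 fun g hg x y => ?_
  · simp [schemeAdj_apply, relIndex_map]
  · have := relIndex_map g ω x
    rw [hg] at this
    simp [dualIdem_eq, Matrix.diagonal_apply, this]

theorem terwilligerSpan_eq_span (ω : V) : G.terwilligerSpan ω
    = Submodule.span ℂ (Set.range fun t : (Finset.univ : Finset (Fin 3 × Fin 3 × Fin 3)) =>
        G.blockMatrix ω t) := by
  refine congrArg (Submodule.span ℂ) (Set.ext fun M => ?_)
  constructor
  · rintro ⟨i, j, k, rfl⟩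
    exact ⟨⟨(i, j, k), Finset.mem_univ _⟩, (G.dualIdem_mul_schemeAdj_mul_dualIdem ω i j k).symm⟩
  · rintro ⟨⟨⟨i, j, k⟩, -⟩, rfl⟩
    exact ⟨i, j, k, (G.dualIdem_mul_schemeAdj_mul_dualIdem ω i j k).symm⟩

theorem IsTripleHomogeneous.apply_eq (h : G.IsTripleHomogeneous)
    {ω : V} {M : Matrix V V ℂ}
    (hM : M ∈ G.stabilizerCentralizer ω) (x y x' y' : V)
    (hxy : G.tripleType ω x y = G.tripleType ω x' y') : M x y = M x' y' := by
  obtain ⟨g, hg, rfl, rfl⟩ := h _ _ _ _ _ _ hxy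
  exact (mem_stabilizerCentralizer_iff.1 hM g hg x y).symm

/-- The one inclusion that needs homogeneity: invariant matrices are constant on types. -/
theorem IsTripleHomogeneous.stabilizerCentralizer_le (h : G.IsTripleHomogeneous) (ω : V) :
    Subalgebra.toSubmodule (G.stabilizerCentralizer ω) ≤ G.terwilligerSpan ω := by
  intro M hM
  rw [terwilligerSpan_eq_span]
  exact mem_span_blockMatrix (h.apply_eq hM) (by simp)

theorem IsTripleHomogeneous.terwilligerSpan_eq (h : G.IsTripleHomogeneous) (ω : V) :
    G.terwilligerSpan ω = Subalgebra.toSubmodule (G.terwilligerAlgebra ω) :=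
  le_antisymm (terwilligerSpan_le ω)
    (le_trans (Subalgebra.toSubmodule.monotone (terwilligerAlgebra_le ω))
      (h.stabilizerCentralizer_le ω))

theorem IsTripleHomogeneous.terwilligerAlgebra_eq (h : G.IsTripleHomogeneous) (ω : V) :
    G.terwilligerAlgebra ω = G.stabilizerCentralizer ω :=
  le_antisymm (terwilligerAlgebra_le ω) fun _ hM =>
    terwilligerSpan_le ω (h.stabilizerCentralizer_le ω hM)

/-- Restricting to admissible types discards only zero matrices, and makes the spanning family a
basis once all these types occur. -/
theorem IsTripleHomogeneous.stabilizerCentralizer_eq_span (h : G.IsTripleHomogeneous) (ω : V) :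
    Subalgebra.toSubmodule (G.stabilizerCentralizer ω)
      = Submodule.span ℂ (Set.range fun t : admissibleTypes => G.blockMatrix ω t) := by
  refine le_antisymm (fun M hM => mem_span_blockMatrix (h.apply_eq hM) fun x y hxy =>
    absurd (G.tripleType_mem_admissibleTypes ω x y) hxy) (Submodule.span_le.2 ?_)
  rintro _ ⟨⟨⟨i, j, k⟩, -⟩, rfl⟩
  refine terwilligerAlgebra_le ω (terwilligerSpan_le ω (Submodule.subset_span ⟨i, j, k, ?_⟩))
  exact (G.dualIdem_mul_schemeAdj_mul_dualIdem ω i j k).symm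

theorem IsTripleHomogeneous.centralizerBlock_eq_span (h : G.IsTripleHomogeneous)
    (ω : V) (i k : Fin 3) :
    G.centralizerBlock ω i k
      = Submodule.span ℂ (Set.range fun t : blockTypes i k => G.blockMatrix ω t) := by
  apply le_antisymm
  · rintro _ ⟨M, hM, rfl⟩
    rw [LinearMap.mulLeftRight_apply]
    refine mem_span_blockMatrix (fun x y x' y' hxy => ?_) fun x y hxy => ?_
    · have hM' := h.apply_eq hM x y x' y' hxy
      simp only [tripleType, Prod.mk.injEq] at hxy
      rw [dualIdem_mul_mul_dualIdem_apply, dualIdem_mul_mul_dualIdem_apply, hM', hxy.1, hxy.2.2]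
    · rw [dualIdem_mul_mul_dualIdem_apply, if_neg]
      intro h'
      exact hxy (Finset.mem_filter.2 ⟨G.tripleType_mem_admissibleTypes ω x y, h'⟩)
  · rw [Submodule.span_le]
    rintro _ ⟨⟨⟨i', j, k'⟩, ht⟩, rfl⟩
    obtain ⟨-, rfl, rfl⟩ := Finset.mem_filter.1 ht
    -- The block matrix is the compression of `A_j`, which lies in the centralizer.
    refine ⟨G.schemeAdj j, terwilligerAlgebra_le ω (Algebra.subset_adjoin (Or.inl ⟨j, rfl⟩)), ?_⟩
    rw [LinearMap.mulLeftRight_apply]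
    exact G.dualIdem_mul_schemeAdj_mul_dualIdem ω _ j _

theorem IsTripleHomogeneous.finrank_stabilizerCentralizer (h : G.IsTripleHomogeneous)
    (hr : G.RealizesTriples) (ω : V) :
    Module.finrank ℂ (G.stabilizerCentralizer ω) = 15 := by
  change Module.finrank ℂ (Subalgebra.toSubmodule (G.stabilizerCentralizer ω)) = 15
  rw [h.stabilizerCentralizer_eq_span, finrank_span_eq_card (linearIndependent_blockMatrix
    fun t ht => hr.exists_tripleType_eq h ω ht), Fintype.card_coe]
  -- Eight types without a zero, six with exactly one zero, and `(0, 0, 0)`.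
  decide

theorem IsTripleHomogeneous.finrank_terwilligerSpan (h : G.IsTripleHomogeneous)
    (hr : G.RealizesTriples) (ω : V) :
    Module.finrank ℂ (G.terwilligerSpan ω) = 15 := by
  rw [h.terwilligerSpan_eq, h.terwilligerAlgebra_eq]
  exact h.finrank_stabilizerCentralizer hr ω

theorem IsTripleHomogeneous.finrank_centralizerBlock (h : G.IsTripleHomogeneous)
    (hr : G.RealizesTriples) (ω : V)
    (i k : Fin 3) : Module.finrank ℂ (G.centralizerBlock ω i k) = (blockTypes i k).card := by
  have hli : LinearIndependent ℂ fun t : blockTypes i k => G.blockMatrix ω t :=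
    linearIndependent_blockMatrix fun t ht => hr.exists_tripleType_eq h ω (Finset.mem_filter.1 ht).1
  rw [h.centralizerBlock_eq_span, finrank_span_eq_card hli, Fintype.card_coe]

theorem IsTripleHomogeneous.of_finrank_centralizerBlock (h : G.IsTripleHomogeneous)
    (hr : G.RealizesTriples) (ω : V) :
    (Matrix.of fun i j : Fin 3 => Module.finrank ℂ (G.centralizerBlock ω i j))
      = !![1, 1, 1; 1, 3, 2; 1, 2, 3] := by
  ext i k
  rw [Matrix.of_apply, h.finrank_centralizerBlock hr]
  fin_cases i <;> fin_cases k <;> rfl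

-- The parameters are read off from one vertex, one adjacent pair and one non-adjacent pair;
-- automorphisms carry the counts to all others.
set_option linter.unusedSectionVars false in
open Classical in
theorem IsTripleHomogeneous.exists_isSRGWith (h : G.IsTripleHomogeneous)
    (hr : G.RealizesTriples) :
    ∃ v k l m : ℕ, G.IsSRGWith v k l m := by
  obtain ⟨x₁, y₁, _, h₁⟩ := hr 1 1 1 (by decide) (by decide) (by decide)
  obtain ⟨x₂, y₂, _, h₂⟩ := hr 2 1 1 (by decide) (by decide) (by decide)
  have key : ∀ x y x' y', G.relIndex x y = G.relIndex x' y' →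
      Fintype.card (G.commonNeighbors x' y') = Fintype.card (G.commonNeighbors x y) := by
    intro x y x' y' hxy
    obtain ⟨g, rfl, rfl⟩ := h.exists_map_pair hxy
    refine (Fintype.card_congr (g.toEquiv.subtypeEquiv fun z => ?_)).symm
    change z ∈ G.commonNeighbors x y ↔ g z ∈ G.commonNeighbors (g x) (g y)
    simp only [mem_commonNeighbors, g.map_adj_iff]
  refine ⟨_, G.degree x₁, Fintype.card (G.commonNeighbors x₁ y₁),
    Fintype.card (G.commonNeighbors x₂ y₂), rfl, fun x => ?_, fun x y hxy => key _ _ _ _ ?_,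
    fun x y hne hxy => key _ _ _ _ ?_⟩
  · obtain ⟨g, rfl⟩ := h.exists_map x x₁
    exact (g.degree_eq x).symm
  · rw [G.relIndex_eq_one.2 hxy]
    exact congrArg Prod.fst h₁
  · rw [G.relIndex_eq_two.2 ⟨hne, hxy⟩]
    exact congrArg Prod.fst h₂

theorem IsTripleHomogeneous.isTriplyTransitive (h : G.IsTripleHomogeneous)
    (hr : G.RealizesTriples) :
    G.IsTriplyTransitive where
  stronglyRegular := h.exists_isSRGWith hr
  vertexTransitive := h.exists_map
  span_eq_terwilliger := h.terwilligerSpan_eq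
  terwilliger_eq_centralizer := h.terwilligerAlgebra_eq

end Blocks

end

end SimpleGraph

namespace SimpleGraph

/-! ### Reduction to one type for each unordered pattern of relations. -/

section TripleTransitivity

variable {V : Type*} (G : SimpleGraph V)

/-- The automorphism group of `G` is transitive on the triples of type `t`. -/
def IsTypeTransitive (t : Fin 3 × Fin 3 × Fin 3) : Prop :=
  ∀ x y z x' y' z' : V, G.tripleType x y z = t → G.tripleType x' y' z' = t →
    ∃ g : G ≃g G, g x = x' ∧ g y = y' ∧ g z = z'

variable {G}

theorem isTypeTransitive_of_exists_map {t : Fin 3 × Fin 3 × Fin 3} (X Y Z : V)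
    (h : ∀ x y z, G.tripleType x y z = t → ∃ g : G ≃g G, g x = X ∧ g y = Y ∧ g z = Z) :
    G.IsTypeTransitive t := by
  intro x y z x' y' z' h₁ h₂
  obtain ⟨g, rfl, rfl, rfl⟩ := h x y z h₁
  obtain ⟨k, h1, h2, h3⟩ := h x' y' z' h₂
  refine ⟨g.trans k.symm, ?_, ?_, ?_⟩
  · exact k.symm_apply_eq.2 h1.symm
  · exact k.symm_apply_eq.2 h2.symm
  · exact k.symm_apply_eq.2 h3.symm

/-- Exchanging the first two vertices permutes the type. With the exchange of the last two this
generates all permutations of the vertices. -/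
theorem IsTypeTransitive.swap_left {i j k : Fin 3} (h : G.IsTypeTransitive (i, j, k)) :
    G.IsTypeTransitive (i, k, j) := by
  intro x y z x' y' z' h₁ h₂
  simp only [tripleType, Prod.mk.injEq] at h₁ h₂
  obtain ⟨g, h1, h2, h3⟩ := h y x z y' x' z'
    (by simp only [tripleType, G.relIndex_comm y x, h₁])
    (by simp only [tripleType, G.relIndex_comm y' x', h₂])
  exact ⟨g, h2, h1, h3⟩

theorem IsTypeTransitive.swap_right {i j k : Fin 3} (h : G.IsTypeTransitive (i, j, k)) :
    G.IsTypeTransitive (k, j, i) := by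
  intro x y z x' y' z' h₁ h₂
  simp only [tripleType, Prod.mk.injEq] at h₁ h₂
  obtain ⟨g, h1, h2, h3⟩ := h x z y x' z' y'
    (by simp only [tripleType, G.relIndex_comm z y, h₁])
    (by simp only [tripleType, G.relIndex_comm z' y', h₂])
  exact ⟨g, h1, h3, h2⟩

theorem isTripleHomogeneous_of_isTypeTransitive
    (h0 : ∀ k, G.IsTypeTransitive (0, k, k)) (h111 : G.IsTypeTransitive (1, 1, 1))
    (h121 : G.IsTypeTransitive (1, 2, 1)) (h221 : G.IsTypeTransitive (2, 2, 1))
    (h222 : G.IsTypeTransitive (2, 2, 2)) : G.IsTripleHomogeneous := by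
  have key : ∀ t ∈ admissibleTypes, G.IsTypeTransitive t := by
    rintro ⟨i, j, k⟩ ht
    simp only [admissibleTypes, Finset.mem_filter, Finset.mem_univ, true_and] at ht
    obtain ⟨h1, h2, h3⟩ := ht
    by_cases hi : i = 0
    · rw [hi, h1 hi]; exact h0 k
    by_cases hk : k = 0
    · rw [hk, ← h2 hk]; exact (h0 i).swap_right
    by_cases hj : j = 0
    · rw [hj, ← h3 hj]; exact (h0 i).swap_right.swap_left
    fin_cases i <;> fin_cases j <;> fin_cases k <;> first | contradiction | skip
    · exact h111
    · exact h121.swap_left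
    · exact h121
    · exact h221.swap_right
    · exact h121.swap_left.swap_right
    · exact h221.swap_left
    · exact h221
    · exact h222
  intro x y z x' y' z' h
  exact key _ (G.tripleType_mem_admissibleTypes x y z) x y z x' y' z' rfl h.symm

end TripleTransitivity

end SimpleGraph

namespace PolarSpace

/-! ### Singular points, and similitudes as graph automorphisms. -/

section Points

variable {F V : Type*} [Field F] [AddCommGroup V] [Module F V] {Q : QuadraticForm F V}

/-- The singular point spanned by a nonzero singular vector. -/
def Point.mk (v : V) (hv : v ≠ 0) (hQ : Q v = 0) : Point Q :=
  ⟨Projectivization.mk F v hv, fun x hx => by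
    rw [Projectivization.submodule_mk, Submodule.mem_span_singleton] at hx
    obtain ⟨r, rfl⟩ := hx
    rw [QuadraticMap.map_smul, hQ, smul_zero]⟩

theorem Point.exists_eq_mk (p : Point Q) : ∃ v hv hQ, p = Point.mk v hv hQ := by
  obtain ⟨p, hp⟩ := p
  induction p using Projectivization.ind with
  | h v hv =>
    refine ⟨v, hv, hp v ?_, rfl⟩
    rw [Projectivization.submodule_mk]
    exact Submodule.mem_span_singleton_self v

theorem Point.mk_eq_mk_iff {v w : V} {hv : v ≠ 0} {hw : w ≠ 0} {hQv : Q v = 0} {hQw : Q w = 0} :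
    Point.mk v hv hQv = Point.mk w hw hQw ↔ ∃ r : F, r • w = v :=
  Subtype.ext_iff.trans (Projectivization.mk_eq_mk_iff' F v w hv hw)

theorem adj_mk_iff {v w : V} {hv : v ≠ 0} {hw : w ≠ 0} {hQv : Q v = 0} {hQw : Q w = 0} :
    (collinearityGraph Q).Adj (Point.mk v hv hQv) (Point.mk w hw hQw) ↔
      (¬ ∃ r : F, r • w = v) ∧ QuadraticMap.polar Q v w = 0 := by
  refine and_congr (not_congr Point.mk_eq_mk_iff) ?_
  simp only [Point.mk, Projectivization.submodule_mk, Submodule.mem_span_singleton]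
  constructor
  · intro h
    exact h v ⟨1, one_smul _ _⟩ w ⟨1, one_smul _ _⟩
  · rintro h _ ⟨r, rfl⟩ _ ⟨s, rfl⟩
    rw [QuadraticMap.polar_smul_left, QuadraticMap.polar_smul_right, h, smul_zero, smul_zero]

/-- A linear map that multiplies the quadratic form by a nonzero scalar. -/
def IsSimilitude (Q : QuadraticForm F V) (g : V →ₗ[F] V) : Prop :=
  ∃ μ : F, μ ≠ 0 ∧ ∀ x, Q (g x) = μ * Q x

theorem IsSimilitude.comp {g k : V →ₗ[F] V} (hg : IsSimilitude Q g) (hk : IsSimilitude Q k) :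
    IsSimilitude Q (g ∘ₗ k) := by
  obtain ⟨μ, hμ, hg⟩ := hg
  obtain ⟨ν, hν, hk⟩ := hk
  exact ⟨μ * ν, mul_ne_zero hμ hν, fun x => by rw [LinearMap.comp_apply, hg, hk, mul_assoc]⟩

/-- A nonzero multiplier preserves singularity and orthogonality, and an injective map of the finite
point set is bijective. Images are specified only up to a scalar. -/
theorem IsSimilitude.exists_iso [Finite V] {g : V →ₗ[F] V} (hg : IsSimilitude Q g)
    (hinj : Function.Injective g) : ∃ φ : collinearityGraph Q ≃g collinearityGraph Q,
      ∀ v hv hQ w hw hQw, (∃ r : F, r • w = g v) → φ (Point.mk v hv hQ) = Point.mk w hw hQw := by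
  obtain ⟨μ, hμ, hg⟩ := hg
  have hne : ∀ v, v ≠ 0 → g v ≠ 0 := fun v hv h => hv (hinj (h.trans g.map_zero.symm))
  have hsing : ∀ v, Q v = 0 → Q (g v) = 0 := fun v hv => by rw [hg, hv, mul_zero]
  have hpolar : ∀ v w, QuadraticMap.polar Q (g v) (g w) = μ * QuadraticMap.polar Q v w := by
    intro v w
    simp only [QuadraticMap.polar, ← map_add, hg]
    ring
  have hspan : ∀ v w : V, (∃ r : F, r • g w = g v) ↔ ∃ r : F, r • w = v := by
    intro v w
    simp only [← map_smul, hinj.eq_iff]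
  let f : Point Q → Point Q := fun p => ⟨p.1.map g hinj, by
    obtain ⟨v, hv, hQ, rfl⟩ := p.exists_eq_mk
    exact (Point.mk (g v) (hne v hv) (hsing v hQ)).2⟩
  have hf : ∀ v hv hQ, f (Point.mk v hv hQ) = Point.mk (g v) (hne v hv) (hsing v hQ) :=
    fun v hv hQ => rfl
  have hfinj : Function.Injective f := by
    intro p r h
    exact Subtype.ext (Projectivization.map_injective g hinj (congrArg Subtype.val h))
  have hbij : Function.Bijective f := Finite.injective_iff_bijective.1 hfinj
  refine ⟨⟨Equiv.ofBijective f hbij, ?_⟩, ?_⟩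
  · intro p r
    obtain ⟨v, hv, hQv, rfl⟩ := p.exists_eq_mk
    obtain ⟨w, hw, hQw, rfl⟩ := r.exists_eq_mk
    rw [Equiv.ofBijective_apply, Equiv.ofBijective_apply, hf, hf, adj_mk_iff, adj_mk_iff, hspan,
      hpolar, mul_eq_zero, or_iff_right hμ]
  · intro v hv hQ w hw hQw h
    exact (hf v hv hQ).trans (Point.mk_eq_mk_iff.2 h)

end Points

/-! ### Anisotropic binary forms. -/

section BinaryForm

variable {F : Type*} [Field F]

/-- A nontrivial zero splits off a linear factor, and the cofactor is again a linear form. Both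
factors vanish at the origin, so neither is a unit. -/
theorem eq_zero_of_irreducible_binaryPoly {a b c : F} (hf : Irreducible (binaryPoly a b c))
    (x y : F) (h : a * x ^ 2 + b * x * y + c * y ^ 2 = 0) : x = 0 ∧ y = 0 := by
  have key : ∀ p r : MvPolynomial (Fin 2) F, binaryPoly a b c = p * r →
      MvPolynomial.eval 0 p = 0 → MvPolynomial.eval 0 r = 0 → False := by
    intro p r hpr hp hr
    rcases hf.isUnit_or_isUnit hpr with hu | hu
    · exact (hu.map (MvPolynomial.eval (0 : Fin 2 → F))).ne_zero hp
    · exact (hu.map (MvPolynomial.eval (0 : Fin 2 → F))).ne_zero hr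
  by_cases hy : y = 0
  · refine ⟨?_, hy⟩
    by_contra hx
    have ha : a = 0 := by simpa [hy, hx] using h
    refine key (MvPolynomial.X 1)
      (MvPolynomial.C b * MvPolynomial.X 0 + MvPolynomial.C c * MvPolynomial.X 1) ?_
      (by simp) (by simp)
    rw [binaryPoly, ha, MvPolynomial.C_0]
    ring
  · exfalso
    have hc : c = -(a * (x / y) ^ 2 + b * (x / y)) := by
      field_simp
      linear_combination h
    refine key (MvPolynomial.X 0 - MvPolynomial.C (x / y) * MvPolynomial.X 1)
      (MvPolynomial.C a * MvPolynomial.X 0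
        + MvPolynomial.C (b + a * (x / y)) * MvPolynomial.X 1) ?_ (by simp) (by simp)
    rw [binaryPoly, hc]
    simp only [map_add, map_mul, map_neg, map_pow]
    ring

/-- Anisotropy of the binary form `a X² + b X Y + c Y²`. -/
def IsAnisotropic (a b c : F) : Prop :=
  ∀ x y : F, a * x ^ 2 + b * x * y + c * y ^ 2 = 0 → x = 0 ∧ y = 0

variable {a b c : F}

theorem IsAnisotropic.ne_zero (h : IsAnisotropic a b c) : a ≠ 0 := by
  rintro rfl
  exact one_ne_zero (h 1 0 (by ring)).1

/-- This form is `a · f(x / a, y)`, the norm form of the quadratic extension. -/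
theorem IsAnisotropic.norm_anisotropic (h : IsAnisotropic a b c) (x y : F)
    (hxy : x ^ 2 + b * x * y + a * c * y ^ 2 = 0) : x = 0 ∧ y = 0 := by
  have ha := h.ne_zero
  obtain ⟨h1, h2⟩ := h (x / a) y (by field_simp; linear_combination hxy)
  exact ⟨by simpa [ha] using h1, h2⟩

variable [Finite F]

/-- In characteristic two every element is a square. Otherwise completing the square gives `s² + d
t²` with `d ≠ 0`, and the value sets of `s² - μ` and `-d t²` are too large to be disjoint. -/
theorem IsAnisotropic.exists_norm_eq (h : IsAnisotropic a b c) (μ : F) :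
    ∃ x y : F, x ^ 2 + b * x * y + a * c * y ^ 2 = μ := by
  have := Fintype.ofFinite F
  by_cases hF : ringChar F = 2
  · obtain ⟨r, rfl⟩ := FiniteField.isSquare_of_char_two hF μ
    exact ⟨r, 0, by ring⟩
  · have h2 : (2 : F) ≠ 0 := Ring.two_ne_zero hF
    have hd : a * c - b ^ 2 / 4 ≠ 0 := by
      intro hd
      refine one_ne_zero (h.norm_anisotropic (-b / 2) 1 ?_).2
      have h4 : (4 : F) ≠ 0 := by
        rw [show (4 : F) = 2 * 2 by norm_num]; exact mul_ne_zero h2 h2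
      field_simp at hd ⊢
      linear_combination hd
    obtain ⟨s, t, hst⟩ := FiniteField.exists_root_sum_quadratic
      (f := Polynomial.C 1 * Polynomial.X ^ 2 + Polynomial.C 0 * Polynomial.X + Polynomial.C (-μ))
      (g := Polynomial.C (a * c - b ^ 2 / 4) * Polynomial.X ^ 2 + Polynomial.C 0 * Polynomial.X
        + Polynomial.C 0)
      (Polynomial.degree_quadratic one_ne_zero) (Polynomial.degree_quadratic hd)
      (FiniteField.odd_card_of_char_ne_two hF)
    refine ⟨s - b / 2 * t, t, ?_⟩
    simp only [Polynomial.eval_add, Polynomial.eval_mul, Polynomial.eval_C, Polynomial.eval_pow,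
      Polynomial.eval_X] at hst
    have h4 : b / 2 * (b / 2) = b ^ 2 / 4 := by
      rw [div_mul_div_comm]; norm_num; ring
    have h5 : b = 2 * (b / 2) := by field_simp
    linear_combination hst - h4 * t ^ 2 + (s * t - b / 2 * t ^ 2) * h5

/-- A nonzero radical vector satisfies `2 f = 0`, which forces characteristic two and then `b = 0`.
Since `a` and `c` are squares, `f` is the square of a linear form and has a nontrivial zero. -/
theorem IsAnisotropic.exists_polar_ne_zero (h : IsAnisotropic a b c) {x y : F}
    (hxy : ¬ (x = 0 ∧ y = 0)) :
    ∃ s t : F, 2 * a * x * s + b * (x * t + y * s) + 2 * c * y * t ≠ 0 := by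
  by_contra! hcon
  have h10 := hcon 1 0
  have h01 := hcon 0 1
  have h2 : (2 : F) * (a * x ^ 2 + b * x * y + c * y ^ 2) = 0 := by
    linear_combination hcon x y
  have h2' : (2 : F) = 0 := (mul_eq_zero.1 h2).resolve_right fun h' => hxy (h x y h')
  have hb : b = 0 := by
    by_contra hb
    refine hxy ⟨?_, ?_⟩
    · have : b * x = 0 := by linear_combination h01 - c * y * h2'
      exact (mul_eq_zero.1 this).resolve_left hb
    · have : b * y = 0 := by linear_combination h10 - a * x * h2'
      exact (mul_eq_zero.1 this).resolve_left hb
  have hF : ringChar F = 2 := by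
    by_contra hF
    exact Ring.two_ne_zero hF h2'
  obtain ⟨s, rfl⟩ := FiniteField.isSquare_of_char_two hF a
  obtain ⟨t, rfl⟩ := FiniteField.isSquare_of_char_two hF c
  have hs : s = 0 := (h t s (by rw [hb]; linear_combination s ^ 2 * t ^ 2 * h2')).2
  exact h.ne_zero (by rw [hs, zero_mul])

end BinaryForm

end PolarSpace

namespace PolarSpace

/-! ### Explicit similitudes of the elliptic form. -/

section EllipticForm

variable {F : Type*} [Field F] {a b c : F}

theorem ellipticForm_eq (x : Fin 6 → F) : ellipticForm a b c x
    = x 0 * x 1 + x 2 * x 3 + (a * x 4 ^ 2 + b * x 4 * x 5 + c * x 5 ^ 2) := by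
  simp [ellipticForm_apply, binaryPoly]

theorem polar_ellipticForm (x y : Fin 6 → F) : QuadraticMap.polar (ellipticForm a b c) x y
    = x 0 * y 1 + x 1 * y 0 + (x 2 * y 3 + x 3 * y 2)
      + (2 * a * x 4 * y 4 + b * (x 4 * y 5 + x 5 * y 4) + 2 * c * x 5 * y 5) := by
  simp only [QuadraticMap.polar, ellipticForm_eq, Pi.add_apply]
  ring

theorem vec6_congr {α : Type*} {x₀ x₁ x₂ x₃ x₄ x₅ y₀ y₁ y₂ y₃ y₄ y₅ : α} (h₀ : x₀ = y₀) (h₁ : x₁ = y₁)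
    (h₂ : x₂ = y₂) (h₃ : x₃ = y₃) (h₄ : x₄ = y₄) (h₅ : x₅ = y₅) :
    ![x₀, x₁, x₂, x₃, x₄, x₅] = ![y₀, y₁, y₂, y₃, y₄, y₅] := by
  rw [h₀, h₁, h₂, h₃, h₄, h₅]

theorem vec6_eta {α : Type*} (x : Fin 6 → α) : x = ![x 0, x 1, x 2, x 3, x 4, x 5] := by
  ext i
  fin_cases i <;> rfl

theorem smul_vec6 (r x₀ x₁ x₂ x₃ x₄ x₅ : F) : r • ![x₀, x₁, x₂, x₃, x₄, x₅]
    = ![r * x₀, r * x₁, r * x₂, r * x₃, r * x₄, r * x₅] := by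
  ext i
  fin_cases i <;> rfl

theorem ellipticForm_vec6 (x₀ x₁ x₂ x₃ x₄ x₅ : F) :
    ellipticForm a b c ![x₀, x₁, x₂, x₃, x₄, x₅]
      = x₀ * x₁ + x₂ * x₃ + (a * x₄ ^ 2 + b * x₄ * x₅ + c * x₅ ^ 2) :=
  ellipticForm_eq _

/-- A kernel vector is singular and orthogonal to everything. Pairing with basis vectors kills its
hyperbolic coordinates, and anisotropy kills the other two. -/
theorem IsSimilitude.injective (h : IsAnisotropic a b c) {g : (Fin 6 → F) →ₗ[F] (Fin 6 → F)}
    (hg : IsSimilitude (ellipticForm a b c) g) : Function.Injective g := by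
  obtain ⟨μ, hμ, hg⟩ := hg
  rw [injective_iff_map_eq_zero]
  intro x hx
  have hpolar : ∀ y, QuadraticMap.polar (ellipticForm a b c) x y = 0 := by
    intro y
    have h1 : μ * QuadraticMap.polar (ellipticForm a b c) x y = 0 := by
      have h2 := hg (x + y)
      have h3 := hg x
      rw [map_add, hx, zero_add] at h2
      rw [hx, QuadraticMap.map_zero] at h3
      simp only [QuadraticMap.polar]
      linear_combination h3 + hg y - h2
    exact (mul_eq_zero.1 h1).resolve_left hμ
  have hQ : ellipticForm a b c x = 0 := by
    have h3 := hg x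
    rw [hx, QuadraticMap.map_zero] at h3
    exact (mul_eq_zero.1 h3.symm).resolve_left hμ
  have h0 : x 0 = 0 := by simpa [polar_ellipticForm] using hpolar ![0, 1, 0, 0, 0, 0]
  have h1 : x 1 = 0 := by simpa [polar_ellipticForm] using hpolar ![1, 0, 0, 0, 0, 0]
  have h2 : x 2 = 0 := by simpa [polar_ellipticForm] using hpolar ![0, 0, 0, 1, 0, 0]
  have h3 : x 3 = 0 := by simpa [polar_ellipticForm] using hpolar ![0, 0, 1, 0, 0, 0]
  rw [ellipticForm_eq, h0, h1, h2, h3] at hQ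
  obtain ⟨h4, h5⟩ := h (x 4) (x 5) (by linear_combination hQ)
  rw [vec6_eta x, h0, h1, h2, h3, h4, h5]
  ext i
  fin_cases i <;> rfl

variable (a b c)

/-- The Siegel transformation with centre the first basis vector. -/
def siegelFst (v₂ v₃ v₄ v₅ : F) : (Fin 6 → F) →ₗ[F] (Fin 6 → F) where
  toFun x := ![x 0 - (x 2 * v₃ + x 3 * v₂
      + (2 * a * x 4 * v₄ + b * (x 4 * v₅ + x 5 * v₄) + 2 * c * x 5 * v₅))
      - x 1 * (v₂ * v₃ + (a * v₄ ^ 2 + b * v₄ * v₅ + c * v₅ ^ 2)),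
    x 1, x 2 + x 1 * v₂, x 3 + x 1 * v₃, x 4 + x 1 * v₄, x 5 + x 1 * v₅]
  map_add' x y := by
    ext i
    fin_cases i <;> simp <;> ring
  map_smul' r x := by
    ext i
    fin_cases i <;> simp <;> ring

/-- The Siegel transformation with centre the third basis vector and axis in the span of the last
two basis vectors. -/
def siegelSnd (v₄ v₅ : F) : (Fin 6 → F) →ₗ[F] (Fin 6 → F) where
  toFun x := ![x 0, x 1, x 2 - (2 * a * x 4 * v₄ + b * (x 4 * v₅ + x 5 * v₄) + 2 * c * x 5 * v₅)
      - x 3 * (a * v₄ ^ 2 + b * v₄ * v₅ + c * v₅ ^ 2),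
    x 3, x 4 + x 3 * v₄, x 5 + x 3 * v₅]
  map_add' x y := by
    ext i
    fin_cases i <;> simp <;> ring
  map_smul' r x := by
    ext i
    fin_cases i <;> simp <;> ring

/-- The block diagonal map that scales the hyperbolic coordinates and acts on the anisotropic plane
as multiplication by an element of the quadratic extension. -/
def blockScale (s₀ s₁ s₂ s₃ p r : F) : (Fin 6 → F) →ₗ[F] (Fin 6 → F) where
  toFun x := ![s₀ * x 0, s₁ * x 1, s₂ * x 2, s₃ * x 3, p * x 4 - c * r * x 5,
    p * x 5 + a * r * x 4 + b * r * x 5]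
  map_add' x y := by
    ext i
    fin_cases i <;> simp <;> ring
  map_smul' r x := by
    ext i
    fin_cases i <;> simp <;> ring

/-- The exchange of the first two coordinates. -/
def swapFst : (Fin 6 → F) →ₗ[F] (Fin 6 → F) := LinearMap.funLeft F F ![1, 0, 2, 3, 4, 5]

/-- The exchange of the third and the fourth coordinate. -/
def swapSnd : (Fin 6 → F) →ₗ[F] (Fin 6 → F) := LinearMap.funLeft F F ![0, 1, 3, 2, 4, 5]

/-- The exchange of the two hyperbolic planes. -/
def swapPlanes : (Fin 6 → F) →ₗ[F] (Fin 6 → F) := LinearMap.funLeft F F ![2, 3, 0, 1, 4, 5]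

theorem siegelFst_vec6 (v₂ v₃ v₄ v₅ x₀ x₁ x₂ x₃ x₄ x₅ : F) :
    siegelFst a b c v₂ v₃ v₄ v₅ ![x₀, x₁, x₂, x₃, x₄, x₅] = ![x₀ - (x₂ * v₃ + x₃ * v₂
      + (2 * a * x₄ * v₄ + b * (x₄ * v₅ + x₅ * v₄) + 2 * c * x₅ * v₅))
      - x₁ * (v₂ * v₃ + (a * v₄ ^ 2 + b * v₄ * v₅ + c * v₅ ^ 2)),
    x₁, x₂ + x₁ * v₂, x₃ + x₁ * v₃, x₄ + x₁ * v₄, x₅ + x₁ * v₅] := rfl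

theorem siegelSnd_vec6 (v₄ v₅ x₀ x₁ x₂ x₃ x₄ x₅ : F) :
    siegelSnd a b c v₄ v₅ ![x₀, x₁, x₂, x₃, x₄, x₅] = ![x₀, x₁,
      x₂ - (2 * a * x₄ * v₄ + b * (x₄ * v₅ + x₅ * v₄) + 2 * c * x₅ * v₅)
      - x₃ * (a * v₄ ^ 2 + b * v₄ * v₅ + c * v₅ ^ 2),
    x₃, x₄ + x₃ * v₄, x₅ + x₃ * v₅] := rfl

theorem blockScale_vec6 (s₀ s₁ s₂ s₃ p r x₀ x₁ x₂ x₃ x₄ x₅ : F) :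
    blockScale a b c s₀ s₁ s₂ s₃ p r ![x₀, x₁, x₂, x₃, x₄, x₅]
      = ![s₀ * x₀, s₁ * x₁, s₂ * x₂, s₃ * x₃, p * x₄ - c * r * x₅,
        p * x₅ + a * r * x₄ + b * r * x₅] := rfl

theorem swapFst_vec6 (x₀ x₁ x₂ x₃ x₄ x₅ : F) :
    swapFst ![x₀, x₁, x₂, x₃, x₄, x₅] = ![x₁, x₀, x₂, x₃, x₄, x₅] := by
  ext i
  fin_cases i <;> rfl

theorem swapSnd_vec6 (x₀ x₁ x₂ x₃ x₄ x₅ : F) :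
    swapSnd ![x₀, x₁, x₂, x₃, x₄, x₅] = ![x₀, x₁, x₃, x₂, x₄, x₅] := by
  ext i
  fin_cases i <;> rfl

theorem swapPlanes_vec6 (x₀ x₁ x₂ x₃ x₄ x₅ : F) :
    swapPlanes ![x₀, x₁, x₂, x₃, x₄, x₅] = ![x₂, x₃, x₀, x₁, x₄, x₅] := by
  ext i
  fin_cases i <;> rfl

theorem isSimilitude_of_vec6 {g : (Fin 6 → F) →ₗ[F] (Fin 6 → F)} {μ : F} (hμ : μ ≠ 0)
    (h : ∀ x₀ x₁ x₂ x₃ x₄ x₅ : F, ellipticForm a b c (g ![x₀, x₁, x₂, x₃, x₄, x₅])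
      = μ * ellipticForm a b c ![x₀, x₁, x₂, x₃, x₄, x₅]) :
    IsSimilitude (ellipticForm a b c) g :=
  ⟨μ, hμ, fun x => by rw [vec6_eta x]; exact h _ _ _ _ _ _⟩

theorem isSimilitude_siegelFst (v₂ v₃ v₄ v₅ : F) :
    IsSimilitude (ellipticForm a b c) (siegelFst a b c v₂ v₃ v₄ v₅) := by
  refine isSimilitude_of_vec6 a b c one_ne_zero fun x₀ x₁ x₂ x₃ x₄ x₅ => ?_
  rw [siegelFst_vec6, ellipticForm_vec6, ellipticForm_vec6]
  ring

theorem isSimilitude_siegelSnd (v₄ v₅ : F) :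
    IsSimilitude (ellipticForm a b c) (siegelSnd a b c v₄ v₅) := by
  refine isSimilitude_of_vec6 a b c one_ne_zero fun x₀ x₁ x₂ x₃ x₄ x₅ => ?_
  rw [siegelSnd_vec6, ellipticForm_vec6, ellipticForm_vec6]
  ring

theorem isSimilitude_swapFst : IsSimilitude (ellipticForm a b c) swapFst := by
  refine isSimilitude_of_vec6 a b c one_ne_zero fun x₀ x₁ x₂ x₃ x₄ x₅ => ?_
  rw [swapFst_vec6, ellipticForm_vec6, ellipticForm_vec6]
  ring

theorem isSimilitude_swapSnd : IsSimilitude (ellipticForm a b c) swapSnd := by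
  refine isSimilitude_of_vec6 a b c one_ne_zero fun x₀ x₁ x₂ x₃ x₄ x₅ => ?_
  rw [swapSnd_vec6, ellipticForm_vec6, ellipticForm_vec6]
  ring

theorem isSimilitude_swapPlanes : IsSimilitude (ellipticForm a b c) swapPlanes := by
  refine isSimilitude_of_vec6 a b c one_ne_zero fun x₀ x₁ x₂ x₃ x₄ x₅ => ?_
  rw [swapPlanes_vec6, ellipticForm_vec6, ellipticForm_vec6]
  ring

/-- Multiplication by an extension element scales `f` by its norm `p² + b p r + a c r²`, which must
match the factors on the two hyperbolic planes. -/
theorem isSimilitude_blockScale {s₀ s₁ s₂ s₃ p r : F} (h : s₀ * s₁ ≠ 0) (h₂ : s₂ * s₃ = s₀ * s₁)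
    (hn : p ^ 2 + b * p * r + a * c * r ^ 2 = s₀ * s₁) :
    IsSimilitude (ellipticForm a b c) (blockScale a b c s₀ s₁ s₂ s₃ p r) := by
  refine isSimilitude_of_vec6 a b c h fun x₀ x₁ x₂ x₃ x₄ x₅ => ?_
  rw [blockScale_vec6, ellipticForm_vec6, ellipticForm_vec6]
  linear_combination x₂ * x₃ * h₂ + (a * x₄ ^ 2 + b * x₄ * x₅ + c * x₅ ^ 2) * hn

theorem isSimilitude_blockScale_inv {s t : F} (hs : s ≠ 0) (ht : t ≠ 0) :
    IsSimilitude (ellipticForm a b c) (blockScale a b c s s⁻¹ t t⁻¹ 1 0) := by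
  refine isSimilitude_blockScale a b c ?_ ?_ ?_ <;> simp [hs, ht]

variable {a b c}

/-- An isometry of the last four coordinates that normalises a nonzero singular vector. -/
theorem exists_similitude_singular (h : IsAnisotropic a b c) {u₂ u₃ u₄ u₅ : F}
    (hu : ¬ (u₂ = 0 ∧ u₃ = 0 ∧ u₄ = 0 ∧ u₅ = 0))
    (hQ : u₂ * u₃ + (a * u₄ ^ 2 + b * u₄ * u₅ + c * u₅ ^ 2) = 0) :
    ∃ g, IsSimilitude (ellipticForm a b c) g ∧ ∀ s t r,
      g ![s, t, r * u₂, r * u₃, r * u₄, r * u₅] = ![s, t, r, 0, 0, 0] := by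
  by_cases h3 : u₃ = 0
  · obtain ⟨rfl, rfl⟩ := h u₄ u₅ (by linear_combination hQ - u₂ * h3)
    have h2 : u₂ ≠ 0 := fun h2 => hu ⟨h2, h3, rfl, rfl⟩
    refine ⟨_, isSimilitude_blockScale_inv a b c one_ne_zero (inv_ne_zero h2), fun s t r => ?_⟩
    rw [blockScale_vec6]
    exact vec6_congr (by simp) (by simp) (by field_simp) (by simp [h3]) (by simp) (by simp)
  -- The Siegel map clears the last two coordinates, and singularity then clears the third.
  · refine ⟨_, ((isSimilitude_blockScale_inv a b c one_ne_zero (inv_ne_zero h3)).comp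
      (isSimilitude_swapSnd a b c)).comp (isSimilitude_siegelSnd a b c (-u₄ / u₃) (-u₅ / u₃)),
      fun s t r => ?_⟩
    rw [LinearMap.comp_apply, LinearMap.comp_apply, siegelSnd_vec6, swapSnd_vec6, blockScale_vec6]
    refine vec6_congr (by simp) (by simp) ?_ ?_ ?_ ?_
    · field_simp
    · field_simp
      linear_combination r * hQ
    · field_simp
      ring
    · field_simp
      ring

/-- An isometry of the last four coordinates that normalises a nonsingular vector. -/
theorem exists_similitude_nonsingular [Finite F] (h : IsAnisotropic a b c) {u₂ u₃ u₄ u₅ d : F}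
    (hd : d ≠ 0) (hQ : u₂ * u₃ + (a * u₄ ^ 2 + b * u₄ * u₅ + c * u₅ ^ 2) = d) :
    ∃ g, IsSimilitude (ellipticForm a b c) g ∧ ∀ s t r,
      g ![s, t, r * u₂, r * u₃, r * u₄, r * u₅] = ![s, t, r * d, r, 0, 0] := by
  have key₃ : ∀ u₂ u₃ u₄ u₅ : F, u₃ ≠ 0 →
      u₂ * u₃ + (a * u₄ ^ 2 + b * u₄ * u₅ + c * u₅ ^ 2) = d →
      ∃ g, IsSimilitude (ellipticForm a b c) g ∧ ∀ s t r,
        g ![s, t, r * u₂, r * u₃, r * u₄, r * u₅] = ![s, t, r * d, r, 0, 0] := by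
    intro u₂ u₃ u₄ u₅ h3 hQ
    refine ⟨_, (isSimilitude_blockScale_inv a b c one_ne_zero h3).comp
      (isSimilitude_siegelSnd a b c (-u₄ / u₃) (-u₅ / u₃)), fun s t r => ?_⟩
    rw [LinearMap.comp_apply, siegelSnd_vec6, blockScale_vec6]
    refine vec6_congr (by simp) (by simp) ?_ ?_ ?_ ?_
    · field_simp
      linear_combination r * hQ
    · field_simp
    · field_simp
      ring
    · field_simp
      ring
  have key₂ : ∀ u₂ u₃ u₄ u₅ : F, u₂ ≠ 0 →
      u₂ * u₃ + (a * u₄ ^ 2 + b * u₄ * u₅ + c * u₅ ^ 2) = d →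
      ∃ g, IsSimilitude (ellipticForm a b c) g ∧ ∀ s t r,
        g ![s, t, r * u₂, r * u₃, r * u₄, r * u₅] = ![s, t, r * d, r, 0, 0] := by
    intro u₂ u₃ u₄ u₅ h2 hQ
    obtain ⟨g, hg, hgx⟩ := key₃ u₃ u₂ u₄ u₅ h2 (by linear_combination hQ)
    refine ⟨_, hg.comp (isSimilitude_swapSnd a b c), fun s t r => ?_⟩
    rw [LinearMap.comp_apply, swapSnd_vec6, hgx]
  by_cases h3 : u₃ = 0
  · by_cases h2 : u₂ = 0
    · have hu : ¬ (u₄ = 0 ∧ u₅ = 0) := by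
        rintro ⟨rfl, rfl⟩
        exact hd (by rw [← hQ, h2]; ring)
      -- The vector lies in the anisotropic plane; a Siegel map along a direction not orthogonal to
      -- it makes the third coordinate nonzero.
      obtain ⟨v, w, hvw⟩ := h.exists_polar_ne_zero hu
      obtain ⟨g, hg, hgx⟩ := key₂
        (-(2 * a * u₄ * v + b * (u₄ * w + u₅ * v) + 2 * c * u₅ * w)) 0 u₄ u₅ (neg_ne_zero.2 hvw)
        (by linear_combination hQ - u₃ * h2)
      refine ⟨_, hg.comp (isSimilitude_siegelSnd a b c v w), fun s t r => ?_⟩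
      rw [LinearMap.comp_apply, siegelSnd_vec6, ← hgx]
      congr 1
      refine vec6_congr rfl rfl ?_ ?_ ?_ ?_ <;> rw [h3] <;> try rw [h2]
      all_goals ring
    · exact key₂ _ _ _ _ h2 hQ
  · exact key₃ _ _ _ _ h3 hQ

end EllipticForm

end PolarSpace

namespace PolarSpace

/-! ### Normal forms of vectors under stabilizers of points and pairs. -/

section NormalForms

variable {F : Type*} [Field F] {a b c : F}

theorem exists_similitude_fst (h : IsAnisotropic a b c) {x : Fin 6 → F} (hx : x ≠ 0)
    (hQ : ellipticForm a b c x = 0) : ∃ g, IsSimilitude (ellipticForm a b c) g ∧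
      ∃ r : F, r • ![1, 0, 0, 0, 0, 0] = g x := by
  obtain ⟨x₀, x₁, x₂, x₃, x₄, x₅, rfl⟩ : ∃ x₀ x₁ x₂ x₃ x₄ x₅, x = ![x₀, x₁, x₂, x₃, x₄, x₅] :=
    ⟨_, _, _, _, _, _, vec6_eta x⟩
  rw [ellipticForm_vec6] at hQ
  have key : ∀ x₀ x₁ : F, x₁ ≠ 0 →
      x₀ * x₁ + x₂ * x₃ + (a * x₄ ^ 2 + b * x₄ * x₅ + c * x₅ ^ 2) = 0 →
      ∃ g, IsSimilitude (ellipticForm a b c) g ∧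
        ∃ r : F, r • ![1, 0, 0, 0, 0, 0] = g ![x₀, x₁, x₂, x₃, x₄, x₅] := by
    intro x₀ x₁ h1 hQ
    refine ⟨_, (isSimilitude_swapFst a b c).comp
      (isSimilitude_siegelFst a b c (-x₂ / x₁) (-x₃ / x₁) (-x₄ / x₁) (-x₅ / x₁)), x₁, ?_⟩
    rw [LinearMap.comp_apply, siegelFst_vec6, swapFst_vec6, smul_vec6]
    refine vec6_congr (by simp) ?_ ?_ ?_ ?_ ?_
    · field_simp
      linear_combination -hQ
    all_goals
      field_simp
      ring
  by_cases h1 : x₁ = 0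
  · by_cases h0 : x₀ = 0
    · obtain ⟨g, hg, hgx⟩ := exists_similitude_singular h (u₂ := x₂) (u₃ := x₃) (u₄ := x₄)
        (u₅ := x₅) (by
          rintro ⟨rfl, rfl, rfl, rfl⟩
          refine hx ?_
          rw [h0, h1]
          ext i
          fin_cases i <;> rfl) (by linear_combination hQ - x₀ * h1)
      refine ⟨_, (isSimilitude_swapPlanes a b c).comp hg, 1, ?_⟩
      have := hgx 0 0 1
      simp only [one_mul] at this
      rw [LinearMap.comp_apply, h0, h1, this, swapPlanes_vec6, one_smul]
    · obtain ⟨g, hg, r, hr⟩ := key x₁ x₀ h0 (by linear_combination hQ)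
      exact ⟨_, hg.comp (isSimilitude_swapFst a b c), r, by
        rw [LinearMap.comp_apply, swapFst_vec6, hr]⟩
  · exact key _ _ h1 hQ

theorem not_all_zero_of_not_smul_eq {x₀ x₂ x₃ x₄ x₅ : F}
    (hx0 : ![x₀, 0, x₂, x₃, x₄, x₅] ≠ 0)
    (hx : ¬ ∃ r : F, r • ![x₀, 0, x₂, x₃, x₄, x₅] = ![1, 0, 0, 0, 0, 0]) :
    ¬ (x₂ = 0 ∧ x₃ = 0 ∧ x₄ = 0 ∧ x₅ = 0) := by
  rintro ⟨rfl, rfl, rfl, rfl⟩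
  have h0 : x₀ ≠ 0 := by
    rintro rfl
    refine hx0 ?_
    ext i
    fin_cases i <;> rfl
  refine hx ⟨x₀⁻¹, ?_⟩
  rw [smul_vec6]
  exact vec6_congr (inv_mul_cancel₀ h0) (by simp) (by simp) (by simp) (by simp) (by simp)

theorem exists_similitude_orthogonal (h : IsAnisotropic a b c) {x : Fin 6 → F}
    (hx0 : x ≠ 0) (hQ : ellipticForm a b c x = 0)
    (hx : ¬ ∃ r : F, r • x = ![1, 0, 0, 0, 0, 0]) (hp : x 1 = 0) :
    ∃ g, IsSimilitude (ellipticForm a b c) g ∧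
      g ![1, 0, 0, 0, 0, 0] = ![1, 0, 0, 0, 0, 0] ∧ g x = ![0, 0, 1, 0, 0, 0] := by
  obtain ⟨x₀, x₁, x₂, x₃, x₄, x₅, rfl⟩ : ∃ x₀ x₁ x₂ x₃ x₄ x₅, x = ![x₀, x₁, x₂, x₃, x₄, x₅] :=
    ⟨_, _, _, _, _, _, vec6_eta x⟩
  obtain rfl : x₁ = 0 := hp
  rw [ellipticForm_vec6] at hQ
  obtain ⟨g, hg, hgx⟩ := exists_similitude_singular h (not_all_zero_of_not_smul_eq hx0 hx)
    (by linear_combination hQ)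
  -- The free parameters give both the image of `x` and the invariance of the first basis vector.
  have h1 := hgx x₀ 0 1
  have h2 := hgx 1 0 0
  simp only [one_mul, zero_mul] at h1 h2
  refine ⟨_, (isSimilitude_siegelFst a b c 0 x₀ 0 0).comp hg, ?_, ?_⟩
  · rw [LinearMap.comp_apply, h2, siegelFst_vec6]
    apply vec6_congr <;> ring
  · rw [LinearMap.comp_apply, h1, siegelFst_vec6]
    apply vec6_congr <;> ring

theorem exists_similitude_hyperbolic {x : Fin 6 → F} (hQ : ellipticForm a b c x = 0)
    (hp : x 1 ≠ 0) : ∃ g, IsSimilitude (ellipticForm a b c) g ∧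
      g ![1, 0, 0, 0, 0, 0] = ![1, 0, 0, 0, 0, 0] ∧
      ∃ r : F, r • ![0, 1, 0, 0, 0, 0] = g x := by
  obtain ⟨x₀, x₁, x₂, x₃, x₄, x₅, rfl⟩ : ∃ x₀ x₁ x₂ x₃ x₄ x₅, x = ![x₀, x₁, x₂, x₃, x₄, x₅] :=
    ⟨_, _, _, _, _, _, vec6_eta x⟩
  replace hp : x₁ ≠ 0 := hp
  rw [ellipticForm_vec6] at hQ
  refine ⟨_, isSimilitude_siegelFst a b c (-x₂ / x₁) (-x₃ / x₁) (-x₄ / x₁) (-x₅ / x₁), ?_, x₁, ?_⟩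
  · rw [siegelFst_vec6]
    apply vec6_congr <;> ring
  · rw [siegelFst_vec6, smul_vec6]
    refine vec6_congr ?_ (by simp) ?_ ?_ ?_ ?_
    · field_simp
      linear_combination -hQ
    all_goals
      field_simp
      ring

/-- Orthogonality to both base points leaves `f(y₄, y₅) = 0`, so anisotropy puts `y` on their line;
a diagonal scaling makes both coordinates 1. -/
theorem exists_similitude_line (h : IsAnisotropic a b c) {y : Fin 6 → F}
    (hy0 : y ≠ 0) (hQ : ellipticForm a b c y = 0)
    (hy : ¬ ∃ r : F, r • y = ![1, 0, 0, 0, 0, 0]) (hy' : ¬ ∃ r : F, r • y = ![0, 0, 1, 0, 0, 0])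
    (hp : y 1 = 0) (hp' : y 3 = 0) :
    ∃ g, IsSimilitude (ellipticForm a b c) g ∧
      (∃ r : F, r • ![1, 0, 0, 0, 0, 0] = g ![1, 0, 0, 0, 0, 0]) ∧
      (∃ r : F, r • ![0, 0, 1, 0, 0, 0] = g ![0, 0, 1, 0, 0, 0]) ∧
      g y = ![1, 0, 1, 0, 0, 0] := by
  obtain ⟨y₀, y₁, y₂, y₃, y₄, y₅, rfl⟩ : ∃ y₀ y₁ y₂ y₃ y₄ y₅, y = ![y₀, y₁, y₂, y₃, y₄, y₅] :=
    ⟨_, _, _, _, _, _, vec6_eta y⟩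
  obtain rfl : y₁ = 0 := hp
  obtain rfl : y₃ = 0 := hp'
  rw [ellipticForm_vec6] at hQ
  obtain ⟨rfl, rfl⟩ := h y₄ y₅ (by linear_combination hQ)
  have h2 : y₂ ≠ 0 := fun h2 => not_all_zero_of_not_smul_eq hy0 hy ⟨h2, rfl, rfl, rfl⟩
  have h0 : y₀ ≠ 0 := by
    rintro rfl
    refine hy' ⟨y₂⁻¹, ?_⟩
    rw [smul_vec6]
    exact vec6_congr (by simp) (by simp) (inv_mul_cancel₀ h2) (by simp) (by simp) (by simp)
  refine ⟨_, isSimilitude_blockScale_inv a b c (inv_ne_zero h0) (inv_ne_zero h2), ⟨y₀⁻¹, ?_⟩,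
    ⟨y₂⁻¹, ?_⟩, ?_⟩
  · rw [blockScale_vec6, smul_vec6]
    apply vec6_congr <;> ring
  · rw [blockScale_vec6, smul_vec6]
    apply vec6_congr <;> ring
  · rw [blockScale_vec6]
    exact vec6_congr (inv_mul_cancel₀ h0) (by ring) (inv_mul_cancel₀ h2) (by ring) (by ring)
      (by ring)

theorem exists_similitude_path {y : Fin 6 → F} (hQ : ellipticForm a b c y = 0)
    (hp : y 1 = 0) (hp' : y 3 ≠ 0) : ∃ g, IsSimilitude (ellipticForm a b c) g ∧
      g ![1, 0, 0, 0, 0, 0] = ![1, 0, 0, 0, 0, 0] ∧ g ![0, 0, 1, 0, 0, 0] = ![0, 0, 1, 0, 0, 0] ∧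
      ∃ r : F, r • ![0, 0, 0, 1, 0, 0] = g y := by
  obtain ⟨y₀, y₁, y₂, y₃, y₄, y₅, rfl⟩ : ∃ y₀ y₁ y₂ y₃ y₄ y₅, y = ![y₀, y₁, y₂, y₃, y₄, y₅] :=
    ⟨_, _, _, _, _, _, vec6_eta y⟩
  obtain rfl : y₁ = 0 := hp
  replace hp' : y₃ ≠ 0 := hp'
  rw [ellipticForm_vec6] at hQ
  -- The inner map clears the third and the last two coordinates, the outer one clears `y₀`.
  refine ⟨_, (isSimilitude_siegelFst a b c (y₀ / y₃) 0 0 0).comp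
    (isSimilitude_siegelSnd a b c (-y₄ / y₃) (-y₅ / y₃)), ?_, ?_, y₃, ?_⟩
  · rw [LinearMap.comp_apply, siegelSnd_vec6, siegelFst_vec6]
    apply vec6_congr <;> ring
  · rw [LinearMap.comp_apply, siegelSnd_vec6, siegelFst_vec6]
    apply vec6_congr <;> ring
  · rw [LinearMap.comp_apply, siegelSnd_vec6, siegelFst_vec6, smul_vec6]
    refine vec6_congr ?_ (by ring) ?_ (by ring) ?_ ?_
    · field_simp
      ring
    · field_simp
      linear_combination -hQ
    all_goals
      field_simp
      ring

theorem exists_similitude_isolated (h : IsAnisotropic a b c) {y : Fin 6 → F} (hy0 : y ≠ 0)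
    (hQ : ellipticForm a b c y = 0) (hy : ¬ ∃ r : F, r • y = ![1, 0, 0, 0, 0, 0])
    (hp : y 1 = 0) (hp' : y 0 ≠ 0) :
    ∃ g, IsSimilitude (ellipticForm a b c) g ∧
      (∃ r : F, r • ![1, 0, 0, 0, 0, 0] = g ![1, 0, 0, 0, 0, 0]) ∧
      (∃ r : F, r • ![0, 1, 0, 0, 0, 0] = g ![0, 1, 0, 0, 0, 0]) ∧
      g y = ![1, 0, 1, 0, 0, 0] := by
  obtain ⟨y₀, y₁, y₂, y₃, y₄, y₅, rfl⟩ : ∃ y₀ y₁ y₂ y₃ y₄ y₅, y = ![y₀, y₁, y₂, y₃, y₄, y₅] :=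
    ⟨_, _, _, _, _, _, vec6_eta y⟩
  obtain rfl : y₁ = 0 := hp
  replace hp' : y₀ ≠ 0 := hp'
  rw [ellipticForm_vec6] at hQ
  obtain ⟨g, hg, hgx⟩ := exists_similitude_singular h (not_all_zero_of_not_smul_eq hy0 hy)
    (by linear_combination hQ)
  have h0 := hgx 1 0 0
  have h1 := hgx 0 1 0
  have h2 := hgx y₀ 0 1
  simp only [one_mul, zero_mul] at h0 h1 h2
  refine ⟨_, (isSimilitude_blockScale_inv a b c (inv_ne_zero hp') one_ne_zero).comp hg,
    ⟨y₀⁻¹, ?_⟩, ⟨y₀⁻¹⁻¹, ?_⟩, ?_⟩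
  · rw [LinearMap.comp_apply, h0, blockScale_vec6, smul_vec6]
    apply vec6_congr <;> ring
  · rw [LinearMap.comp_apply, h1, blockScale_vec6, smul_vec6]
    apply vec6_congr <;> ring
  · rw [LinearMap.comp_apply, h2, blockScale_vec6]
    exact vec6_congr (inv_mul_cancel₀ hp') (by ring) (by ring) (by ring) (by ring) (by ring)

/-- The last four coordinates have value `-y₀ y₁ ≠ 0` and can be normalised to `(-y₀ y₁, 1, 0, 0)`.
Scaling `y₀` and `y₁` to 1 has multiplier `(y₀ y₁)⁻¹`, which must be a norm for the map to extend to
the anisotropic plane. -/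
theorem exists_similitude_triad [Finite F] (h : IsAnisotropic a b c) {y : Fin 6 → F}
    (hQ : ellipticForm a b c y = 0) (hp : y 1 ≠ 0) (hp' : y 0 ≠ 0) :
    ∃ g, IsSimilitude (ellipticForm a b c) g ∧
      (∃ r : F, r • ![1, 0, 0, 0, 0, 0] = g ![1, 0, 0, 0, 0, 0]) ∧
      (∃ r : F, r • ![0, 1, 0, 0, 0, 0] = g ![0, 1, 0, 0, 0, 0]) ∧
      g y = ![1, 1, -1, 1, 0, 0] := by
  obtain ⟨y₀, y₁, y₂, y₃, y₄, y₅, rfl⟩ : ∃ y₀ y₁ y₂ y₃ y₄ y₅, y = ![y₀, y₁, y₂, y₃, y₄, y₅] :=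
    ⟨_, _, _, _, _, _, vec6_eta y⟩
  replace hp : y₁ ≠ 0 := hp
  replace hp' : y₀ ≠ 0 := hp'
  rw [ellipticForm_vec6] at hQ
  obtain ⟨g, hg, hgx⟩ := exists_similitude_nonsingular h (u₂ := y₂) (u₃ := y₃) (u₄ := y₄)
    (u₅ := y₅) (neg_ne_zero.2 (mul_ne_zero hp' hp)) (by linear_combination hQ)
  have h0 := hgx 1 0 0
  have h1 := hgx 0 1 0
  have h2 := hgx y₀ y₁ 1
  simp only [one_mul, zero_mul] at h0 h1 h2
  obtain ⟨p, r, hpr⟩ := h.exists_norm_eq (y₀⁻¹ * y₁⁻¹)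
  refine ⟨_, (isSimilitude_blockScale a b c (s₀ := y₀⁻¹) (s₁ := y₁⁻¹) (s₂ := y₀⁻¹ * y₁⁻¹)
    (s₃ := 1) (mul_ne_zero (inv_ne_zero hp') (inv_ne_zero hp)) (mul_one _) hpr).comp hg,
    ⟨y₀⁻¹, ?_⟩, ⟨y₁⁻¹, ?_⟩, ?_⟩
  · rw [LinearMap.comp_apply, h0, blockScale_vec6, smul_vec6]
    apply vec6_congr <;> ring
  · rw [LinearMap.comp_apply, h1, blockScale_vec6, smul_vec6]
    apply vec6_congr <;> ring
  · rw [LinearMap.comp_apply, h2, blockScale_vec6]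
    refine vec6_congr (inv_mul_cancel₀ hp') (inv_mul_cancel₀ hp) ?_ (by ring) (by ring) (by ring)
    field_simp

end NormalForms

/-! ### Transitivity on each type of triples. -/

section Transitivity

variable {F V : Type*} [Field F] [AddCommGroup V] [Module F V] {Q : QuadraticForm F V}

theorem relIndex_mk_eq_one {v w : V} {hv : v ≠ 0} {hw : w ≠ 0} {hQv : Q v = 0} {hQw : Q w = 0} :
    (collinearityGraph Q).relIndex (Point.mk v hv hQv) (Point.mk w hw hQw) = 1 ↔
      (¬ ∃ r : F, r • w = v) ∧ QuadraticMap.polar Q v w = 0 :=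
  (SimpleGraph.relIndex_eq_one _).trans adj_mk_iff

/-- Distinctness is automatic: a singular vector is orthogonal to its own multiples. -/
theorem relIndex_mk_eq_two {v w : V} {hv : v ≠ 0} {hw : w ≠ 0} {hQv : Q v = 0} {hQw : Q w = 0} :
    (collinearityGraph Q).relIndex (Point.mk v hv hQv) (Point.mk w hw hQw) = 2 ↔
      QuadraticMap.polar Q v w ≠ 0 := by
  rw [SimpleGraph.relIndex_eq_two, adj_mk_iff, Ne, Point.mk_eq_mk_iff]
  constructor
  · rintro ⟨h1, h2⟩ h3
    exact h2 ⟨h1, h3⟩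
  · refine fun h => ⟨?_, fun h' => h h'.2⟩
    rintro ⟨r, rfl⟩
    refine h ?_
    rw [QuadraticMap.polar_smul_left, QuadraticMap.polar_self, hQw, smul_zero, smul_zero]

end Transitivity

section EllipticQuadric

open SimpleGraph

variable {F : Type*} [Field F] {a b c : F}

theorem ne_zero_of_apply_eq_one {x : Fin 6 → F} (i : Fin 6) (h : x i = 1) : x ≠ 0 := by
  rintro rfl
  exact zero_ne_one h

variable (a b c)

/-- The point spanned by the first basis vector. -/
abbrev pointFst : Point (ellipticForm a b c) :=
  Point.mk ![1, 0, 0, 0, 0, 0] (ne_zero_of_apply_eq_one 0 rfl)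
    (by simp [ellipticForm_eq])

/-- The point spanned by the second basis vector. -/
abbrev pointSnd : Point (ellipticForm a b c) :=
  Point.mk ![0, 1, 0, 0, 0, 0] (ne_zero_of_apply_eq_one 1 rfl)
    (by simp [ellipticForm_eq])

/-- The point spanned by the third basis vector. -/
abbrev pointTrd : Point (ellipticForm a b c) :=
  Point.mk ![0, 0, 1, 0, 0, 0] (ne_zero_of_apply_eq_one 2 rfl)
    (by simp [ellipticForm_eq])

/-- The point spanned by the fourth basis vector. -/
abbrev pointFth : Point (ellipticForm a b c) :=
  Point.mk ![0, 0, 0, 1, 0, 0] (ne_zero_of_apply_eq_one 3 rfl)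
    (by simp [ellipticForm_eq])

/-- The point spanned by the sum of the first and the third basis vector. -/
abbrev pointSum : Point (ellipticForm a b c) :=
  Point.mk ![1, 0, 1, 0, 0, 0] (ne_zero_of_apply_eq_one 0 rfl)
    (by simp [ellipticForm_eq])

/-- A point that is not collinear with `pointFst` and `pointSnd`. -/
abbrev pointTriad : Point (ellipticForm a b c) :=
  Point.mk ![1, 1, -1, 1, 0, 0] (ne_zero_of_apply_eq_one 0 rfl)
    (by simp [ellipticForm_eq])

variable {a b c} [Finite F]

theorem exists_iso_fst (h : IsAnisotropic a b c) (x : Point (ellipticForm a b c)) :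
    ∃ g : collinearityGraph (ellipticForm a b c) ≃g collinearityGraph (ellipticForm a b c),
      g x = pointFst a b c := by
  obtain ⟨x, hx, hQ, rfl⟩ := x.exists_eq_mk
  obtain ⟨g, hg, hgx⟩ := exists_similitude_fst h hx hQ
  obtain ⟨φ, hφ⟩ := hg.exists_iso (hg.injective h)
  exact ⟨φ, hφ _ _ _ _ _ _ hgx⟩

theorem exists_iso_one (h : IsAnisotropic a b c) (x y : Point (ellipticForm a b c))
    (hxy : (collinearityGraph (ellipticForm a b c)).relIndex x y = 1) :
    ∃ g : collinearityGraph (ellipticForm a b c) ≃g collinearityGraph (ellipticForm a b c),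
      g x = pointFst a b c ∧ g y = pointTrd a b c := by
  obtain ⟨ψ, hψ⟩ := exists_iso_fst h x
  rw [← relIndex_map ψ, hψ] at hxy
  obtain ⟨y', hy', hQ, hy⟩ := (ψ y).exists_eq_mk
  rw [hy] at hxy
  obtain ⟨h1, h2⟩ := relIndex_mk_eq_one.1 hxy
  obtain ⟨g, hg, hg0, hgy⟩ := exists_similitude_orthogonal h hy' hQ h1
    (by simpa [polar_ellipticForm] using h2)
  obtain ⟨φ, hφ⟩ := hg.exists_iso (hg.injective h)
  refine ⟨ψ.trans φ, ?_, ?_⟩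
  · refine (congrArg φ hψ).trans (hφ _ _ _ _ _ _ ⟨1, ?_⟩)
    rw [one_smul, hg0]
  · refine (congrArg φ hy).trans (hφ _ _ _ _ _ _ ⟨1, ?_⟩)
    rw [one_smul, hgy]

theorem exists_iso_two (h : IsAnisotropic a b c) (x y : Point (ellipticForm a b c))
    (hxy : (collinearityGraph (ellipticForm a b c)).relIndex x y = 2) :
    ∃ g : collinearityGraph (ellipticForm a b c) ≃g collinearityGraph (ellipticForm a b c),
      g x = pointFst a b c ∧ g y = pointSnd a b c := by
  obtain ⟨ψ, hψ⟩ := exists_iso_fst h x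
  rw [← relIndex_map ψ, hψ] at hxy
  obtain ⟨y', hy', hQ, hy⟩ := (ψ y).exists_eq_mk
  rw [hy] at hxy
  have h2 := relIndex_mk_eq_two.1 hxy
  obtain ⟨g, hg, hg0, hgy⟩ := exists_similitude_hyperbolic hQ
    (by simpa [polar_ellipticForm] using h2)
  obtain ⟨φ, hφ⟩ := hg.exists_iso (hg.injective h)
  refine ⟨ψ.trans φ, ?_, ?_⟩
  · refine (congrArg φ hψ).trans (hφ _ _ _ _ _ _ ⟨1, ?_⟩)
    rw [one_smul, hg0]
  · exact (congrArg φ hy).trans (hφ _ _ _ _ _ _ hgy)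

/-- Reduction of transitivity on triples to the stabiliser of a pair of points. -/
theorem isTypeTransitive_of_exists_similitude (h : IsAnisotropic a b c) {i j k : Fin 3}
    {u v w : Fin 6 → F} {hu : u ≠ 0} {hQu : ellipticForm a b c u = 0}
    {hv : v ≠ 0} {hQv : ellipticForm a b c v = 0} (hw : w ≠ 0) (hQw : ellipticForm a b c w = 0)
    (hpair : ∀ x y, (collinearityGraph (ellipticForm a b c)).relIndex x y = i →
      ∃ g : collinearityGraph (ellipticForm a b c) ≃g collinearityGraph (ellipticForm a b c),
        g x = Point.mk u hu hQu ∧ g y = Point.mk v hv hQv)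
    (hthird : ∀ z hz hQz,
      (collinearityGraph (ellipticForm a b c)).relIndex (Point.mk v hv hQv)
        (Point.mk z hz hQz) = j →
      (collinearityGraph (ellipticForm a b c)).relIndex (Point.mk u hu hQu)
        (Point.mk z hz hQz) = k →
      ∃ g, IsSimilitude (ellipticForm a b c) g ∧ (∃ r : F, r • u = g u) ∧ (∃ r : F, r • v = g v) ∧
        ∃ r : F, r • w = g z) :
    (collinearityGraph (ellipticForm a b c)).IsTypeTransitive (i, j, k) := by
  refine isTypeTransitive_of_exists_map (Point.mk u hu hQu) (Point.mk v hv hQv)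
    (Point.mk w hw hQw) fun x y z hxyz => ?_
  simp only [tripleType, Prod.mk.injEq] at hxyz
  obtain ⟨hxy, hyz, hxz⟩ := hxyz
  obtain ⟨ψ, hψx, hψy⟩ := hpair x y hxy
  rw [← relIndex_map ψ, hψy] at hyz
  rw [← relIndex_map ψ, hψx] at hxz
  obtain ⟨z', hz', hQz, hz⟩ := (ψ z).exists_eq_mk
  rw [hz] at hyz hxz
  obtain ⟨g, hg, hgu, hgv, hgz⟩ := hthird z' hz' hQz hyz hxz
  obtain ⟨φ, hφ⟩ := hg.exists_iso (hg.injective h)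
  exact ⟨ψ.trans φ, (congrArg φ hψx).trans (hφ _ _ _ _ _ _ hgu),
    (congrArg φ hψy).trans (hφ _ _ _ _ _ _ hgv), (congrArg φ hz).trans (hφ _ _ _ _ _ _ hgz)⟩

/-- The first two vertices coincide, so transitivity on pairs suffices. -/
theorem isTypeTransitive_zero (h : IsAnisotropic a b c) (k : Fin 3) :
    (collinearityGraph (ellipticForm a b c)).IsTypeTransitive (0, k, k) := by
  have key : ∃ X Y, ∀ x y, (collinearityGraph (ellipticForm a b c)).relIndex x y = k →
      ∃ g : collinearityGraph (ellipticForm a b c) ≃g collinearityGraph (ellipticForm a b c),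
        g x = X ∧ g y = Y := by
    fin_cases k
    · refine ⟨pointFst a b c, pointFst a b c, fun x y hxy => ?_⟩
      obtain rfl := (relIndex_eq_zero _).1 hxy
      obtain ⟨g, hg⟩ := exists_iso_fst h x
      exact ⟨g, hg, hg⟩
    · exact ⟨_, _, exists_iso_one h⟩
    · exact ⟨_, _, exists_iso_two h⟩
  obtain ⟨X, Y, hXY⟩ := key
  refine isTypeTransitive_of_exists_map X X Y fun x y z hxyz => ?_
  simp only [tripleType, Prod.mk.injEq] at hxyz
  obtain ⟨hxy, -, hxz⟩ := hxyz
  obtain rfl := (relIndex_eq_zero _).1 hxy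
  obtain ⟨g, hgx, hgz⟩ := hXY x z hxz
  exact ⟨g, hgx, hgx, hgz⟩

theorem isTypeTransitive_line (h : IsAnisotropic a b c) :
    (collinearityGraph (ellipticForm a b c)).IsTypeTransitive (1, 1, 1) := by
  refine isTypeTransitive_of_exists_similitude h (ne_zero_of_apply_eq_one 0 rfl)
    (w := ![1, 0, 1, 0, 0, 0]) (by simp [ellipticForm_eq]) (exists_iso_one h)
    fun z hz hQ hyz hxz => ?_
  obtain ⟨h1, h2⟩ := relIndex_mk_eq_one.1 hxz
  obtain ⟨h3, h4⟩ := relIndex_mk_eq_one.1 hyz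
  obtain ⟨g, hg, hu, hv, hgz⟩ := exists_similitude_line h hz hQ h1 h3
    (by simpa [polar_ellipticForm] using h2) (by simpa [polar_ellipticForm] using h4)
  exact ⟨g, hg, hu, hv, 1, by rw [one_smul, hgz]⟩

theorem isTypeTransitive_path (h : IsAnisotropic a b c) :
    (collinearityGraph (ellipticForm a b c)).IsTypeTransitive (1, 2, 1) := by
  refine isTypeTransitive_of_exists_similitude h (ne_zero_of_apply_eq_one 3 rfl)
    (w := ![0, 0, 0, 1, 0, 0]) (by simp [ellipticForm_eq]) (exists_iso_one h)
    fun z hz hQ hyz hxz => ?_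
  have h2 := (relIndex_mk_eq_one.1 hxz).2
  have h4 := relIndex_mk_eq_two.1 hyz
  obtain ⟨g, hg, hu, hv, hgz⟩ := exists_similitude_path hQ
    (by simpa [polar_ellipticForm] using h2) (by simpa [polar_ellipticForm] using h4)
  exact ⟨g, hg, ⟨1, by rw [one_smul, hu]⟩, ⟨1, by rw [one_smul, hv]⟩, hgz⟩

theorem isTypeTransitive_isolated (h : IsAnisotropic a b c) :
    (collinearityGraph (ellipticForm a b c)).IsTypeTransitive (2, 2, 1) := by
  refine isTypeTransitive_of_exists_similitude h (ne_zero_of_apply_eq_one 0 rfl)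
    (w := ![1, 0, 1, 0, 0, 0]) (by simp [ellipticForm_eq]) (exists_iso_two h)
    fun z hz hQ hyz hxz => ?_
  obtain ⟨h1, h2⟩ := relIndex_mk_eq_one.1 hxz
  have h4 := relIndex_mk_eq_two.1 hyz
  obtain ⟨g, hg, hu, hv, hgz⟩ := exists_similitude_isolated h hz hQ h1
    (by simpa [polar_ellipticForm] using h2) (by simpa [polar_ellipticForm] using h4)
  exact ⟨g, hg, hu, hv, 1, by rw [one_smul, hgz]⟩

theorem isTypeTransitive_triad (h : IsAnisotropic a b c) :
    (collinearityGraph (ellipticForm a b c)).IsTypeTransitive (2, 2, 2) := by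
  refine isTypeTransitive_of_exists_similitude h (ne_zero_of_apply_eq_one 0 rfl)
    (w := ![1, 1, -1, 1, 0, 0]) (by simp [ellipticForm_eq]) (exists_iso_two h)
    fun z hz hQ hyz hxz => ?_
  have h2 := relIndex_mk_eq_two.1 hxz
  have h4 := relIndex_mk_eq_two.1 hyz
  obtain ⟨g, hg, hu, hv, hgz⟩ := exists_similitude_triad h hQ
    (by simpa [polar_ellipticForm] using h2) (by simpa [polar_ellipticForm] using h4)
  exact ⟨g, hg, hu, hv, 1, by rw [one_smul, hgz]⟩

theorem isTripleHomogeneous_collinearityGraph (h : IsAnisotropic a b c) :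
    (collinearityGraph (ellipticForm a b c)).IsTripleHomogeneous :=
  isTripleHomogeneous_of_isTypeTransitive (isTypeTransitive_zero h) (isTypeTransitive_line h)
    (isTypeTransitive_path h) (isTypeTransitive_isolated h) (isTypeTransitive_triad h)

end EllipticQuadric

end PolarSpace

namespace PolarSpace

/-! ### Every nondegenerate type occurs. -/

section Realization

open SimpleGraph

variable {F : Type*} [Field F] {a b c : F}

/-- The coordinate `i` certifies that the two points are distinct. -/
theorem relIndex_mk_eq_one_of_apply {Q : QuadraticForm F (Fin 6 → F)} {v w : Fin 6 → F}
    {hv : v ≠ 0} {hw : w ≠ 0} {hQv : Q v = 0} {hQw : Q w = 0} (i : Fin 6) (hvi : v i = 1)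
    (hwi : w i = 0) (h : QuadraticMap.polar Q v w = 0) :
    (collinearityGraph Q).relIndex (Point.mk v hv hQv) (Point.mk w hw hQw) = 1 := by
  refine relIndex_mk_eq_one.2 ⟨?_, h⟩
  rintro ⟨r, rfl⟩
  rw [Pi.smul_apply, hwi, smul_zero] at hvi
  exact zero_ne_one hvi

theorem realizesTriples_collinearityGraph :
    (collinearityGraph (ellipticForm a b c)).RealizesTriples := by
  let G := collinearityGraph (ellipticForm a b c)
  have h13 : G.relIndex (pointFst a b c) (pointTrd a b c) = 1 :=
    relIndex_mk_eq_one_of_apply 0 rfl rfl (by simp [polar_ellipticForm])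
  have h14 : G.relIndex (pointFst a b c) (pointFth a b c) = 1 :=
    relIndex_mk_eq_one_of_apply 0 rfl rfl (by simp [polar_ellipticForm])
  have h23 : G.relIndex (pointSnd a b c) (pointTrd a b c) = 1 :=
    relIndex_mk_eq_one_of_apply 1 rfl rfl (by simp [polar_ellipticForm])
  have hs1 : G.relIndex (pointSum a b c) (pointFst a b c) = 1 :=
    relIndex_mk_eq_one_of_apply 2 rfl rfl (by simp [polar_ellipticForm])
  have hs3 : G.relIndex (pointSum a b c) (pointTrd a b c) = 1 :=
    relIndex_mk_eq_one_of_apply 0 rfl rfl (by simp [polar_ellipticForm])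
  have h12 : G.relIndex (pointFst a b c) (pointSnd a b c) = 2 :=
    relIndex_mk_eq_two.2 (by simp [polar_ellipticForm])
  have h34 : G.relIndex (pointTrd a b c) (pointFth a b c) = 2 :=
    relIndex_mk_eq_two.2 (by simp [polar_ellipticForm])
  have hs2 : G.relIndex (pointSum a b c) (pointSnd a b c) = 2 :=
    relIndex_mk_eq_two.2 (by simp [polar_ellipticForm])
  have h1t : G.relIndex (pointFst a b c) (pointTriad a b c) = 2 :=
    relIndex_mk_eq_two.2 (by simp [polar_ellipticForm])
  have h2t : G.relIndex (pointSnd a b c) (pointTriad a b c) = 2 :=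
    relIndex_mk_eq_two.2 (by simp [polar_ellipticForm])
  have key : ∀ {x y z : Point (ellipticForm a b c)} {i j k : Fin 3}, G.relIndex x y = i →
      G.relIndex y z = j → G.relIndex x z = k → ∃ x y z, G.tripleType x y z = (i, j, k) :=
    fun {x y z _ _ _} hi hj hk => ⟨x, y, z, by rw [tripleType, hi, hj, hk]⟩
  intro i j k hi hj hk
  fin_cases i <;> fin_cases j <;> fin_cases k <;> first | contradiction | skip
  · exact key ((G.relIndex_comm _ _).trans hs1) hs3 h13
  · exact key h13 ((G.relIndex_comm _ _).trans h23) h12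
  · exact key h13 h34 h14
  · exact key ((G.relIndex_comm _ _).trans hs1) hs2 h12
  · exact key h12 h23 h13
  · exact key ((G.relIndex_comm _ _).trans h12) ((G.relIndex_comm _ _).trans hs1)
      ((G.relIndex_comm _ _).trans hs2)
  · exact key h12 ((G.relIndex_comm _ _).trans hs2) ((G.relIndex_comm _ _).trans hs1)
  · exact key h12 h2t h1t

end Realization

end PolarSpace

theorem theorem3p4 (q : ℕ) (hq : IsPrimePow q)
    {F : Type*} [Field F] [Fintype F] (hF : Fintype.card F = q)
    (a b c : F) (hf : Irreducible (PolarSpace.binaryPoly a b c)) :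
    (PolarSpace.collinearityGraph (PolarSpace.ellipticForm a b c)).IsTriplyTransitive ∧
    ∀ ω : PolarSpace.Point (PolarSpace.ellipticForm a b c),
      Module.finrank ℂ
        ((PolarSpace.collinearityGraph (PolarSpace.ellipticForm a b c)).terwilligerSpan ω) = 15 ∧
      (Matrix.of fun i j : Fin 3 => Module.finrank ℂ
        ((PolarSpace.collinearityGraph
          (PolarSpace.ellipticForm a b c)).centralizerBlock ω i j))
        = !![1, 1, 1; 1, 3, 2; 1, 2, 3] ∧
      Module.finrank ℂ
        ((PolarSpace.collinearityGraph
          (PolarSpace.ellipticForm a b c)).stabilizerCentralizer ω) = 15 := by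
  have h := PolarSpace.isTripleHomogeneous_collinearityGraph
    (PolarSpace.eq_zero_of_irreducible_binaryPoly hf)
  have hr := PolarSpace.realizesTriples_collinearityGraph (a := a) (b := b) (c := c)
  exact ⟨h.isTriplyTransitive hr, fun ω => ⟨h.finrank_terwilligerSpan hr ω,
    h.of_finrank_centralizerBlock hr ω, h.finrank_stabilizerCentralizer hr ω⟩⟩
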